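/- **Conventions.** $\mathbb{CH}^n$ is the unit ball $\mathbb{B}^n\subset\mathbb{C}^n$ with $(z,w)=\sum_i z_i\overline{w_i}$, automorphism group $PU(n,1)$ (acting by fractional linear maps) and distance $\beta=\operatorname{artanh}\rho$, where $\rho(z,w)^2=1-\frac{(1-|z|^2)(1-|w|^2)}{|1-(z,w)|^2}$. A *complex geodesic* is the image of the slice $\{(\zeta,0,\dots,0):|\zeta|<1\}$ under an automorphism. Area in a complex geodesic is the hyperbolic area of curvature $-1$, i.e. the area transported from the disk, where the area element is $\frac{4\,dx\,dy}{(1-|\zeta|^2)^2}$. The symplectic form is $$\omega_z(u,v)=\frac{4\operatorname{Im}\big((1-|z|^2)\langle u,v\rangle+\langle u,z\rangle\langle z,v\rangle\big)}{(1-|z|^2)^2},\qquad \langle u,v\rangle=\sum_i\overline{u_i}v_i,$$ which on the disk is this area form. For $a,b,c\in\mathbb{CH}^n$ let $\Delta$ be the geodesic triangle with these vertices. Its *symplectic area* is $\mathcal{SA}(\Delta)=\int_\Sigma\omega$, where $\Sigma$ is any smooth surface spanning $\Delta$ (a smooth map of the closed unit square into $\mathbb{CH}^n$ that collapses one edge to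 the vertex $a$ and carries the other three edges onto the sides $ab$, $bc$, $ac$ of $\Delta$). The *angular invariant* is $A(x,y,z)=\arg(k_{xy}k_{yz}k_{zx})\in(-\pi,\pi]$ with $k_{xy}=\frac{1}{1-(y,x)}$. **Theorem 5.7.** Let $X=\{x_1,x_2,x_3\}$ be a set of three distinct points of $\mathbb{CH}^n$, let $\Delta_X$ be the geodesic triangle with vertices $x_1,x_2,x_3$, and put $A_{123}=A(x_1,x_2,x_3)$. Spanning surfaces of $\Delta_X$ exist, and $\mathcal{SA}(\Delta_X)$ does not depend on the one that is used. Each side of $\Delta_X$ lies in a unique complex geodesic $G$, and each $x_k$ has a unique nearest point $\Pi x_k$ in $G$. Let $\Delta_{\Pi X}\subset G$ be the solid geodesic triangle with vertices $\Pi x_1,\Pi x_2,\Pi x_3$. Then, whichever side was chosen, $$\tfrac12\operatorname{Area}(\Delta_{\Pi X})=\left|\mathcal{SA}(\Delta_X)/2\right|=|A_{123}|.$$ -/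

import Mathlib

open scoped ContDiff ENNReal

noncomputable section

namespace CHyp

/-- The ambient complex Euclidean space of the ball model of `CH^n`. -/
abbrev Cn (n : ℕ) : Type := EuclideanSpace ℂ (Fin n)

/-- The open unit ball of `ℂ^n`: the underlying set of complex hyperbolic space `CH^n`. -/
def ball (n : ℕ) : Set (Cn n) := Metric.ball 0 1

/-- The open unit disk of `ℂ`: the underlying set of `CH^1`. -/
def disk : Set ℂ := Metric.ball 0 1

/-! ### Metric, geodesics, triangles -/

/-- The pseudohyperbolic metric of the ball,
`ρ(z,w)² = 1 - (1-|z|²)(1-|w|²)/|1-(z,w)|²`. It satisfies `ρ(0,z) = |z|` and is invariant under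
the automorphisms of the ball. -/
def rho {n : ℕ} (z w : Cn n) : ℝ :=
  Real.sqrt (1 - (1 - ‖z‖ ^ 2) * (1 - ‖w‖ ^ 2) / ‖1 - inner ℂ z w‖ ^ 2)

/-- The Bergman-Poincare distance `β = artanh ρ` of the ball, equivalently
`cosh β(z,w) = |1-(z,w)| / √((1-|z|²)(1-|w|²))`. It is the length metric generated by `ρ`, the
distance function of the invariant Riemannian metric that is Euclidean at the origin. -/
def beta {n : ℕ} (z w : Cn n) : ℝ := Real.artanh (rho z w)

/-- The geodesic segment with endpoints `p` and `q`: the points of `CH^n` lying metrically between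
`p` and `q`. -/
def geodesicSegment {n : ℕ} (p q : Cn n) : Set (Cn n) :=
  {z | z ∈ ball n ∧ beta p z + beta z q = beta p q}

/-- The solid triangle with vertices `a, b, c`: the union of the geodesic segments that join `a`
to the points of the opposite side. For three points of a complex geodesic (a hyperbolic plane)
this is the region bounded by the geodesic triangle, together with its boundary. -/
def solidTriangle {n : ℕ} (a b c : Cn n) : Set (Cn n) :=
  {z | ∃ w ∈ geodesicSegment b c, z ∈ geodesicSegment a w}

/-- `p` is a point of `G` nearest to `x` in the hyperbolic metric. -/
def IsNearestPoint {n : ℕ} (G : Set (Cn n)) (x p : Cn n) : Prop :=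
  p ∈ G ∧ ∀ q ∈ G, beta x p ≤ beta x q

/-! ### Automorphisms and complex geodesics -/

/-- The Hermitian form of signature `(n,1)` on `ℂ^n × ℂ = ℂ^(n+1)`,
`[x,y] = ∑ i ≤ n, x_i conj(y_i) - x_(n+1) conj(y_(n+1))`. -/
def form {n : ℕ} (x y : Cn n × ℂ) : ℂ :=
  inner ℂ y.1 x.1 - x.2 * (starRingEnd ℂ) y.2

/-- `f` is (on the ball) an automorphism of `CH^n`: the projective action, in the affine chart
`z ↦ (z,1)`, of a linear automorphism of `ℂ^(n+1)` that preserves the Hermitian form. -/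
def IsBallAut {n : ℕ} (f : Cn n → Cn n) : Prop :=
  ∃ T : (Cn n × ℂ) ≃ₗ[ℂ] (Cn n × ℂ),
    (∀ u v, form (T u) (T v) = form u v) ∧
    ∀ z ∈ ball n, f z = (T (z, 1)).2⁻¹ • (T (z, 1)).1

/-- The point `(ζ, 0, …, 0)` of `ℂ^n`. -/
def axis (n : ℕ) (ζ : ℂ) : Cn n :=
  WithLp.toLp 2 (fun k : Fin n => if (k : ℕ) = 0 then ζ else 0)

/-- `ψ` is an isometric holomorphic parametrization of `G` by the disk `CH^1`: an automorphism of
`CH^n` restricted to the slice `{(ζ, 0, …, 0) : |ζ| < 1}`, with image `G`. -/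
def IsDiskChart {n : ℕ} (ψ : ℂ → Cn n) (G : Set (Cn n)) : Prop :=
  (∃ f : Cn n → Cn n, IsBallAut f ∧ ∀ ζ ∈ disk, ψ ζ = f (axis n ζ)) ∧ G = ψ '' disk

/-- A complex geodesic of `CH^n`: the image of the slice `{(ζ, 0, …, 0) : |ζ| < 1}` under an
automorphism. -/
def IsComplexGeodesic {n : ℕ} (G : Set (Cn n)) : Prop := ∃ ψ : ℂ → Cn n, IsDiskChart ψ G

/-! ### Area and symplectic area -/

/-- Hyperbolic area of a subset of the disk, for the Poincare metric of curvature `-1`, whose area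
element is `4 dx dy / (1-|ζ|²)²`. -/
def hypArea (S : Set ℂ) : ℝ≥0∞ :=
  ∫⁻ ζ in S, ENNReal.ofReal (4 / (1 - ‖ζ‖ ^ 2) ^ 2)

/-- The symplectic (Kaehler) form of `CH^n` at `z`, applied to the tangent vectors `u, v`,
`4 Im ((1-|z|²) ⟨u,v⟩ + ⟨u,z⟩⟨z,v⟩) / (1-|z|²)²` with `⟨u,v⟩ = ∑ conj(u_i) v_i`. It is normalized so
that for `n = 1` it is the area form `4 dx ∧ dy / (1-|z|²)²` of curvature `-1`. -/
def omega {n : ℕ} (z u v : Cn n) : ℝ :=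
  4 * (((1 - ‖z‖ ^ 2 : ℝ) : ℂ) * inner ℂ u v + inner ℂ u z * inner ℂ z v).im /
    (1 - ‖z‖ ^ 2) ^ 2

/-- The closed unit square. -/
def square : Set (ℝ × ℝ) := Set.Icc 0 1 ×ˢ Set.Icc 0 1

/-- `σ` is a smooth surface in `CH^n` spanning the geodesic triangle with vertices `a, b, c`,
parametrized by the unit square: the edge `s = 0` is collapsed to the vertex `a`, and the other
three edges run along the sides `ab`, `bc`, `ac`. -/
structure IsSpanningSurface {n : ℕ} (a b c : Cn n) (σ : ℝ × ℝ → Cn n) : Prop where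
  smooth : ContDiffOn ℝ ∞ σ square
  mem_ball : ∀ p ∈ square, σ p ∈ ball n
  vertex_a : ∀ t ∈ Set.Icc (0 : ℝ) 1, σ (0, t) = a
  vertex_b : σ (1, 0) = b
  vertex_c : σ (1, 1) = c
  side_ab : ∀ s ∈ Set.Icc (0 : ℝ) 1, σ (s, 0) ∈ geodesicSegment a b
  side_bc : ∀ t ∈ Set.Icc (0 : ℝ) 1, σ (1, t) ∈ geodesicSegment b c
  side_ac : ∀ s ∈ Set.Icc (0 : ℝ) 1, σ (s, 1) ∈ geodesicSegment a c

/-- The integral of the symplectic form over a surface parametrized by the unit square. -/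
def integralOmega {n : ℕ} (σ : ℝ × ℝ → Cn n) : ℝ :=
  ∫ p in square, omega (σ p) (fderivWithin ℝ σ square p (1, 0)) (fderivWithin ℝ σ square p (0, 1))

/-- The symplectic area of the geodesic triangle with vertices `a, b, c` is (well defined and)
equal to `A`: spanning surfaces exist, and the integral of the symplectic form over each of them
is `A`. -/
def HasSymplecticArea {n : ℕ} (a b c : Cn n) (A : ℝ) : Prop :=
  (∃ σ, IsSpanningSurface a b c σ) ∧ ∀ σ, IsSpanningSurface a b c σ → integralOmega σ = A

/-! ### The angular invariant -/

/-- The Drury-Arveson kernel entry `k_xy = k_x(y) = 1 / (1 - (y,x))`, `(y,x) = ∑ y_i conj(x_i)`. -/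
def kernel {n : ℕ} (x y : Cn n) : ℂ := 1 / (1 - inner ℂ x y)

/-- The angular invariant `A(x,y,z) = arg (k_xy k_yz k_zx)`. -/
def angularInvariant {n : ℕ} (x y z : Cn n) : ℝ :=
  Complex.arg (kernel x y * kernel y z * kernel z x)

end CHyp

end

/-!
The symplectic form is exact, `ω = dη` with `η_z(u) = 2 Im⟨z,u⟩ / (1-|z|²)`, so by Stokes' theorem
the integral of `ω` over a spanning surface is the sum of the integrals of `η` along the sides. The
integral of `η` along the side from `p` to `q` is `2 arg k_pq`. Each of these arguments is smaller
than `π/2` in absolute value, and moving a vertex to the origin makes two of the kernels equal to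
`1`, so no multiple of `2π` is lost in adding them up: the symplectic area is `2 A(a,b,c)`.

Move a complex geodesic through two of the points to the slice `ℂ × 0`. The nearest point of the
slice to `z` is its orthogonal projection `(z₀, 0)`, and `(z,w)` does not change under this
projection if `z` or `w` lies in the slice already. Of any two of the three points one does, so the
projected triple has the same angular invariant. Finally, a solid triangle in the disk is a cone
over one of its sides; this cone is injective where it is regular, and its Jacobian has constant
sign, so that the area of the triangle is `|∫ ω|` over the cone, that is `2 |A|`.
-/

noncomputable section

namespace CHyp

variable {n : ℕ}

lemma mem_ball_iff {z : Cn n} : z ∈ ball n ↔ ‖z‖ < 1 := by simp [ball]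

lemma zero_mem_ball : (0 : Cn n) ∈ ball n := by simp [ball]

lemma one_sub_norm_sq_pos {z : Cn n} (hz : z ∈ ball n) : 0 < 1 - ‖z‖ ^ 2 := by
  have := mem_ball_iff.1 hz
  nlinarith [norm_nonneg z]

lemma mem_ball_of_one_sub_norm_sq_pos {z : Cn n} (h : 0 < 1 - ‖z‖ ^ 2) : z ∈ ball n := by
  rw [mem_ball_iff]
  nlinarith [norm_nonneg z]

lemma inner_self_ofReal (z : Cn n) : inner ℂ z z = ((‖z‖ ^ 2 : ℝ) : ℂ) := by
  rw [inner_self_eq_norm_sq_to_K]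
  push_cast
  rfl

lemma one_sub_inner_re_pos {z w : Cn n} (hz : z ∈ ball n) (hw : w ∈ ball n) :
    0 < (1 - inner ℂ z w : ℂ).re := by
  have hz := mem_ball_iff.1 hz
  have hw := mem_ball_iff.1 hw
  have hinner := (Complex.re_le_norm (inner ℂ z w)).trans (norm_inner_le_norm z w)
  simp only [Complex.sub_re, Complex.one_re]
  nlinarith [norm_nonneg z, norm_nonneg w]

lemma one_sub_inner_ne_zero {z w : Cn n} (hz : z ∈ ball n) (hw : w ∈ ball n) :
    (1 - inner ℂ z w : ℂ) ≠ 0 := fun h => by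
  simpa [h] using one_sub_inner_re_pos hz hw

/-! ### The unitary group of signature `(n, 1)` -/

section form

variable (c : ℂ) (X Y Z : Cn n × ℂ)

lemma form_add_left : form (X + Y) Z = form X Z + form Y Z := by
  simp only [form, Prod.fst_add, Prod.snd_add, inner_add_right]
  ring

lemma form_smul_left : form (c • X) Z = c * form X Z := by
  simp only [form, Prod.smul_fst, Prod.smul_snd, inner_smul_right, smul_eq_mul]
  ring

lemma form_conj : (starRingEnd ℂ) (form X Y) = form Y X := by
  simp only [form, map_sub, map_mul, inner_conj_symm, Complex.conj_conj]
  ring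

lemma form_add_right : form Z (X + Y) = form Z X + form Z Y := by
  rw [← form_conj, form_add_left, map_add, form_conj, form_conj]

lemma form_smul_right : form Z (c • X) = (starRingEnd ℂ) c * form Z X := by
  rw [← form_conj, form_smul_left, map_mul, form_conj]

end form

lemma form_self (X : Cn n × ℂ) : form X X = ((‖X.1‖ ^ 2 - ‖X.2‖ ^ 2 : ℝ) : ℂ) := by
  rw [form, inner_self_ofReal, Complex.mul_conj, Complex.normSq_eq_norm_sq]
  push_cast
  rfl

lemma form_lift (z w : Cn n) : form (z, 1) (w, 1) = inner ℂ w z - 1 := by simp [form]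

/-- The group `U(n,1)` of linear automorphisms of `ℂ^(n+1)` that preserve the Hermitian form. -/
def unitaryGroup (n : ℕ) : Subgroup ((Cn n × ℂ) ≃ₗ[ℂ] (Cn n × ℂ)) where
  carrier := {T | ∀ X Y, form (T X) (T Y) = form X Y}
  one_mem' := fun _ _ => rfl
  mul_mem' := fun {S T} hS hT X Y => (hS (T X) (T Y)).trans (hT X Y)
  inv_mem' := fun {T} hT X Y => by
    rw [← hT (T⁻¹ X), ← LinearEquiv.mul_apply, ← LinearEquiv.mul_apply, mul_inv_cancel]
    rfl

lemma form_map (T : unitaryGroup n) (X Y : Cn n × ℂ) : form (T.1 X) (T.1 Y) = form X Y :=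
  T.2 X Y

/-- The last coordinate of the image under `T` of the lift `(z, 1)` of `z`, i.e. the denominator of
the fractional linear map induced by `T`. -/
def denom (T : unitaryGroup n) (z : Cn n) : ℂ := (T.1 (z, 1)).2

/-- The fractional linear action of `U(n,1)` in the affine chart `z ↦ (z, 1)`. -/
def act (T : unitaryGroup n) (z : Cn n) : Cn n := (denom T z)⁻¹ • (T.1 (z, 1)).1

lemma act_eq_of_lift {T : unitaryGroup n} {z w : Cn n} {c : ℂ} (hc : c ≠ 0)
    (h : T.1 (z, 1) = c • (w, (1 : ℂ))) : act T z = w := by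
  simp [act, denom, h, smul_smul, hc]

section act

variable (T : unitaryGroup n) {x y z w : Cn n}

lemma denom_ne_zero (hz : z ∈ ball n) : denom T z ≠ 0 := fun h => by
  have hform : ‖(T.1 (z, 1)).1‖ ^ 2 - ‖denom T z‖ ^ 2 = ‖z‖ ^ 2 - 1 := by
    have := form_map T (z, 1) (z, 1)
    rw [form_self, form_self] at this
    simpa [denom] using Complex.ofReal_injective this
  rw [h, norm_zero] at hform
  nlinarith [one_sub_norm_sq_pos hz, sq_nonneg ‖(T.1 (z, 1)).1‖]

lemma map_lift (hz : z ∈ ball n) : T.1 (z, 1) = denom T z • (act T z, (1 : ℂ)) := by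
  ext1
  · simp [act, smul_smul, denom_ne_zero T hz]
  · simp [denom]

lemma one_sub_inner_act (hz : z ∈ ball n) (hw : w ∈ ball n) :
    denom T w * (starRingEnd ℂ) (denom T z) * (1 - inner ℂ (act T z) (act T w))
      = 1 - inner ℂ z w := by
  have h := form_map T (w, 1) (z, 1)
  rw [map_lift T hz, map_lift T hw, form_smul_left, form_smul_right, form_lift, form_lift] at h
  linear_combination -h

lemma one_sub_norm_sq_act (hz : z ∈ ball n) :
    ‖denom T z‖ ^ 2 * (1 - ‖act T z‖ ^ 2) = 1 - ‖z‖ ^ 2 := by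
  have h := one_sub_inner_act T hz hz
  rw [inner_self_ofReal, inner_self_ofReal, Complex.mul_conj, Complex.normSq_eq_norm_sq] at h
  exact_mod_cast h

lemma act_mem_ball (hz : z ∈ ball n) : act T z ∈ ball n := by
  refine mem_ball_of_one_sub_norm_sq_pos (pos_of_mul_pos_right ?_ (sq_nonneg ‖denom T z‖))
  rw [one_sub_norm_sq_act T hz]
  exact one_sub_norm_sq_pos hz

lemma mul_act (S : unitaryGroup n) (hz : z ∈ ball n) : act (S * T) z = act S (act T z) := by
  refine act_eq_of_lift
    (mul_ne_zero (denom_ne_zero T hz) (denom_ne_zero S (act_mem_ball T hz))) ?_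
  rw [mul_smul, ← map_lift S (act_mem_ball T hz), ← map_smul, ← map_lift T hz]
  rfl

lemma one_act (z : Cn n) : act 1 z = z := act_eq_of_lift one_ne_zero (one_smul ℂ _).symm

lemma act_inv_act (hz : z ∈ ball n) : act T⁻¹ (act T z) = z := by
  rw [← mul_act T T⁻¹ hz, inv_mul_cancel, one_act]

lemma act_act_inv (hz : z ∈ ball n) : act T (act T⁻¹ z) = z := by
  simpa using act_inv_act T⁻¹ hz

lemma rho_act (hz : z ∈ ball n) (hw : w ∈ ball n) : rho (act T z) (act T w) = rho z w := by
  have hdz := denom_ne_zero T hz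
  have hdw := denom_ne_zero T hw
  have hscale : ‖denom T w‖ ^ 2 * ‖denom T z‖ ^ 2 ≠ 0 := by positivity
  unfold rho
  rw [← one_sub_norm_sq_act T hz, ← one_sub_norm_sq_act T hw, ← one_sub_inner_act T hz hw,
    norm_mul, norm_mul, RCLike.norm_conj, mul_pow, mul_pow, ← mul_div_mul_left _ _ hscale]
  ring_nf

lemma beta_act (hz : z ∈ ball n) (hw : w ∈ ball n) : beta (act T z) (act T w) = beta z w := by
  rw [beta, rho_act T hz hw, beta]

lemma kernel_act (hz : z ∈ ball n) (hw : w ∈ ball n) :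
    kernel (act T z) (act T w) = denom T w * (starRingEnd ℂ) (denom T z) * kernel z w := by
  rw [kernel, kernel, ← one_sub_inner_act T hz hw]
  have hdz : (starRingEnd ℂ) (denom T z) ≠ 0 := by simpa using denom_ne_zero T hz
  have hdw := denom_ne_zero T hw
  field_simp

lemma angularInvariant_act (hx : x ∈ ball n) (hy : y ∈ ball n) (hz : z ∈ ball n) :
    angularInvariant (act T x) (act T y) (act T z) = angularInvariant x y z := by
  have hscale : 0 < Complex.normSq (denom T x) * Complex.normSq (denom T y)
      * Complex.normSq (denom T z) := by
    have := Complex.normSq_pos.2 (denom_ne_zero T hx)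
    have := Complex.normSq_pos.2 (denom_ne_zero T hy)
    have := Complex.normSq_pos.2 (denom_ne_zero T hz)
    positivity
  rw [angularInvariant, angularInvariant,
    ← Complex.arg_real_mul (kernel x y * kernel y z * kernel z x) hscale]
  congr 1
  rw [kernel_act T hx hy, kernel_act T hy hz, kernel_act T hz hx]
  push_cast
  rw [← Complex.mul_conj, ← Complex.mul_conj, ← Complex.mul_conj]
  ring

end act

/-! ### Complex reflections -/

/-- The complex reflection in the form-orthogonal complement of `V`, as an element of `U(n,1)`. If
`V` is isotropic, then `x / 0 = 0` makes it the identity. -/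
def reflection (V : Cn n × ℂ) : unitaryGroup n :=
  ⟨LinearEquiv.ofInvolutive
    { toFun := fun X => X - (2 * form X V / form V V) • V
      map_add' := fun X Y => by
        simp only [form_add_left, mul_add, add_div, add_smul]
        abel
      map_smul' := fun c X => by
        simp only [form_smul_left, smul_sub, smul_smul, RingHom.id_apply]
        congr 2
        ring }
    (fun X => by
      by_cases hV : form V V = 0
      · simp [hV]
      simp only [LinearMap.coe_mk, AddHom.coe_mk, sub_eq_add_neg, ← neg_smul, form_add_left,
        form_smul_left, add_assoc, ← add_smul]
      rw [add_eq_left]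
      convert zero_smul ℂ V
      field_simp
      ring), fun X Y => by
    have hconj : (starRingEnd ℂ) (form V V) = form V V := form_conj V V
    by_cases hV : form V V = 0
    · simp [hV]
    simp only [LinearEquiv.coe_ofInvolutive, LinearMap.coe_mk, AddHom.coe_mk, sub_eq_add_neg,
      ← neg_smul, form_add_left, form_smul_left, form_add_right, form_smul_right, map_neg,
      map_div₀, map_mul, form_conj, hconj, Complex.conj_ofNat]
    field_simp
    ring⟩

lemma reflection_apply (V X : Cn n × ℂ) :
    (reflection V).1 X = X - (2 * form X V / form V V) • V := rfl

lemma reflection_mul_self (V : Cn n × ℂ) : reflection V * reflection V = 1 :=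
  Subtype.ext (LinearEquiv.ext fun X => LinearEquiv.symm_apply_apply (reflection V).1 X)

/-- The involutive automorphism that exchanges `0` and the point `p` of the ball. It is the
complex reflection in the sum of the lifts of `0` and `p` of norm `-1`, up to a scalar. -/
def exchange (p : Cn n) : unitaryGroup n := reflection (p, 1 + (√(1 - ‖p‖ ^ 2) : ℂ))

section exchange

variable {p z w : Cn n}

lemma sqrt_one_sub_norm_sq_pos (hp : p ∈ ball n) : 0 < √(1 - ‖p‖ ^ 2) :=
  Real.sqrt_pos.2 (one_sub_norm_sq_pos hp)

lemma exchange_lift (hp : p ∈ ball n) (z : Cn n) :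
    (exchange p).1 (z, 1) = (-(√(1 - ‖p‖ ^ 2) : ℂ)⁻¹) •
      ((1 - inner ℂ p z / (1 + √(1 - ‖p‖ ^ 2)) : ℂ) • p - (√(1 - ‖p‖ ^ 2) : ℂ) • z,
        1 - inner ℂ p z) := by
  have hs := sqrt_one_sub_norm_sq_pos hp
  have hsq : (√(1 - ‖p‖ ^ 2) : ℂ) ^ 2 = 1 - (‖p‖ : ℂ) ^ 2 := by
    exact_mod_cast Real.sq_sqrt (one_sub_norm_sq_pos hp).le
  rw [exchange, reflection_apply]
  set s := √(1 - ‖p‖ ^ 2)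
  have hs0 : (s : ℂ) ≠ 0 := by exact_mod_cast hs.ne'
  have hs1 : (1 + s : ℂ) ≠ 0 := by exact_mod_cast (by positivity : 1 + s ≠ 0)
  have hVV : form (p, (1 + s : ℂ)) (p, (1 + s : ℂ)) = -2 * (s * (1 + s)) := by
    simp only [form, inner_self_ofReal, map_add, map_one, Complex.conj_ofReal]
    push_cast
    linear_combination hsq
  have hzV : form (z, 1) (p, (1 + s : ℂ)) = inner ℂ p z - (1 + s) := by
    simp only [form, map_add, map_one, Complex.conj_ofReal, one_mul]
  rw [hVV, hzV]
  ext1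
  · simp only [Prod.smul_mk, Prod.fst_sub]
    match_scalars <;> field_simp
    ring
  · simp only [Prod.smul_mk, Prod.snd_sub, smul_eq_mul]
    field_simp
    ring

lemma denom_exchange (hp : p ∈ ball n) (z : Cn n) :
    denom (exchange p) z = -(1 - inner ℂ p z) / √(1 - ‖p‖ ^ 2) := by
  rw [denom, exchange_lift hp, Prod.smul_mk, smul_eq_mul]
  ring

lemma act_exchange (hp : p ∈ ball n) (z : Cn n) :
    act (exchange p) z = (1 - inner ℂ p z : ℂ)⁻¹ •
      ((1 - inner ℂ p z / (1 + √(1 - ‖p‖ ^ 2)) : ℂ) • p - (√(1 - ‖p‖ ^ 2) : ℂ) • z) := by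
  have hs : (√(1 - ‖p‖ ^ 2) : ℂ) ≠ 0 := by exact_mod_cast (sqrt_one_sub_norm_sq_pos hp).ne'
  rw [act, denom, exchange_lift hp, Prod.smul_mk, smul_eq_mul, smul_smul]
  congr 1
  field_simp

lemma act_exchange_zero (hp : p ∈ ball n) : act (exchange p) 0 = p := by
  simp [act_exchange hp]

lemma act_exchange_act_exchange (hz : z ∈ ball n) :
    act (exchange p) (act (exchange p) z) = z := by
  rw [← mul_act _ _ hz, exchange, reflection_mul_self, one_act]

lemma act_exchange_self (hp : p ∈ ball n) : act (exchange p) p = 0 := by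
  simpa [act_exchange_zero hp] using act_exchange_act_exchange (p := p) zero_mem_ball

end exchange

/-! ### The pseudohyperbolic metric and the angular invariant -/

section rho

variable {z w : Cn n}

lemma rho_nonneg (z w : Cn n) : 0 ≤ rho z w := Real.sqrt_nonneg _

lemma rho_zero_left (z : Cn n) : rho 0 z = ‖z‖ := by simp [rho]

lemma rho_eq_norm_act_exchange (hz : z ∈ ball n) (hw : w ∈ ball n) :
    rho z w = ‖act (exchange z) w‖ := by
  rw [← rho_act (exchange z) hz hw, act_exchange_self hz, rho_zero_left]

lemma rho_mem_Ioo (hz : z ∈ ball n) (hw : w ∈ ball n) : rho z w ∈ Set.Ioo (-1 : ℝ) 1 := by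
  refine ⟨by linarith [rho_nonneg z w], ?_⟩
  rw [rho_eq_norm_act_exchange hz hw]
  exact mem_ball_iff.1 (act_mem_ball _ hw)

lemma rho_eq_zero_iff (hz : z ∈ ball n) (hw : w ∈ ball n) : rho z w = 0 ↔ z = w := by
  rw [rho_eq_norm_act_exchange hz hw, norm_eq_zero]
  refine ⟨fun h => ?_, fun h => h ▸ act_exchange_self hz⟩
  rw [← act_exchange_act_exchange (p := z) hw, h, act_exchange_zero hz]

lemma one_sub_rho_sq (hz : z ∈ ball n) (hw : w ∈ ball n) :
    (1 - rho z w ^ 2) * ‖(1 - inner ℂ z w : ℂ)‖ ^ 2 = (1 - ‖z‖ ^ 2) * (1 - ‖w‖ ^ 2) := by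
  have h := one_sub_norm_sq_act (exchange z) hw
  rw [denom_exchange hz, norm_div, norm_neg, div_pow, Complex.norm_real, Real.norm_eq_abs, sq_abs,
    Real.sq_sqrt (one_sub_norm_sq_pos hz).le] at h
  rw [rho_eq_norm_act_exchange hz hw, ← h]
  have := one_sub_norm_sq_pos hz
  field_simp

end rho

section angularInvariant

variable {x y z : Cn n}

lemma abs_arg_kernel_lt (hx : x ∈ ball n) (hy : y ∈ ball n) :
    |(kernel x y).arg| < Real.pi / 2 := by
  rw [kernel, one_div, Complex.abs_arg_inv]
  exact Complex.abs_arg_lt_pi_div_two_iff.2 (.inl (one_sub_inner_re_pos hx hy))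

lemma kernel_ne_zero (hx : x ∈ ball n) (hy : y ∈ ball n) : kernel x y ≠ 0 :=
  one_div_ne_zero (one_sub_inner_ne_zero hx hy)

lemma conj_kernel (x y : Cn n) : (starRingEnd ℂ) (kernel x y) = kernel y x := by
  simp [kernel, inner_conj_symm]

lemma arg_kernel_swap (hx : x ∈ ball n) (hy : y ∈ ball n) :
    (kernel y x).arg = -(kernel x y).arg := by
  rw [← conj_kernel, Complex.arg_conj, if_neg]
  have := abs_lt.1 (abs_arg_kernel_lt hx hy)
  linarith [Real.pi_pos]

lemma angularInvariant_zero_left (y z : Cn n) : angularInvariant 0 y z = (kernel y z).arg := by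
  simp [angularInvariant, kernel]

/-- Moving `x` to the origin turns the product of the three kernel entries into a single one, up to
a positive factor. -/
lemma abs_angularInvariant_lt (hx : x ∈ ball n) (hy : y ∈ ball n) (hz : z ∈ ball n) :
    |angularInvariant x y z| < Real.pi / 2 := by
  rw [← angularInvariant_act (exchange x) hx hy hz, act_exchange_self hx,
    angularInvariant_zero_left]
  exact abs_arg_kernel_lt (act_mem_ball _ hy) (act_mem_ball _ hz)

lemma arg_mul_of_abs_lt {ζ ξ : ℂ} (hζ : ζ ≠ 0) (hξ : ξ ≠ 0) (hζ' : |ζ.arg| < Real.pi / 2)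
    (hξ' : |ξ.arg| < Real.pi / 2) : (ζ * ξ).arg = ζ.arg + ξ.arg := by
  rw [abs_lt] at hζ' hξ'
  exact Complex.arg_mul hζ hξ ⟨by linarith, by linarith⟩

lemma angularInvariant_eq_sum_arg (hx : x ∈ ball n) (hy : y ∈ ball n) (hz : z ∈ ball n) :
    angularInvariant x y z = (kernel x y).arg + (kernel y z).arg + (kernel z x).arg := by
  have hxy := kernel_ne_zero hx hy
  have hyz := kernel_ne_zero hy hz
  have hzx := kernel_ne_zero hz hx
  have hA := arg_mul_of_abs_lt (mul_ne_zero (mul_ne_zero hxy hyz) hzx) (inv_ne_zero hzx)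
    (abs_angularInvariant_lt hx hy hz) (by
      rw [Complex.abs_arg_inv]
      exact abs_arg_kernel_lt hz hx)
  rw [mul_inv_cancel_right₀ hzx, arg_mul_of_abs_lt hxy hyz (abs_arg_kernel_lt hx hy)
    (abs_arg_kernel_lt hy hz), Complex.arg_inv, if_neg] at hA
  · rw [angularInvariant]
    linarith
  · have := (abs_lt.1 (abs_arg_kernel_lt hz hx)).2
    linarith [Real.pi_pos]

end angularInvariant

/-! ### Geodesic segments -/

lemma artanh_add {x y : ℝ} (hx : x ∈ Set.Ico (0 : ℝ) 1) (hy : y ∈ Set.Ico (0 : ℝ) 1) :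
    Real.artanh x + Real.artanh y = Real.artanh ((x + y) / (1 + x * y)) := by
  have hx' : x ∈ Set.Ioo (-1 : ℝ) 1 := ⟨by linarith [hx.1], hx.2⟩
  have hy' : y ∈ Set.Ioo (-1 : ℝ) 1 := ⟨by linarith [hy.1], hy.2⟩
  have : 0 < √(1 - x ^ 2) := Real.sqrt_pos.2 (by nlinarith [hx.1, hx.2])
  have : 0 < √(1 - y ^ 2) := Real.sqrt_pos.2 (by nlinarith [hy.1, hy.2])
  have : 0 < 1 + x * y := by nlinarith [hx.1, hy.1]
  rw [← Real.artanh_tanh (Real.artanh x + Real.artanh y), Real.tanh_eq_sinh_div_cosh,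
    Real.sinh_add, Real.cosh_add, Real.sinh_artanh hx', Real.sinh_artanh hy',
    Real.cosh_artanh hx', Real.cosh_artanh hy']
  congr 1
  field_simp

section segment

variable {p q z w : Cn n}

lemma norm_mul_norm_lt_one (hz : z ∈ ball n) (hw : w ∈ ball n) : ‖z‖ * ‖w‖ < 1 := by
  have := mem_ball_iff.1 hz
  have := mem_ball_iff.1 hw
  nlinarith [norm_nonneg z, norm_nonneg w]

lemma beta_zero_add_beta_eq_iff (hz : z ∈ ball n) (hq : q ∈ ball n) :
    beta 0 z + beta z q = beta 0 q ↔ rho z q * (1 - ‖z‖ * ‖q‖) = ‖q‖ - ‖z‖ := by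
  have hz' := mem_ball_iff.1 hz
  have hq' := mem_ball_iff.1 hq
  have hrho := (rho_mem_Ioo hz hq).2
  have hrho' := rho_nonneg z q
  have hden : 0 < 1 + ‖z‖ * rho z q := by positivity
  rw [beta, beta, beta, rho_zero_left, rho_zero_left,
    artanh_add ⟨norm_nonneg _, hz'⟩ ⟨hrho', hrho⟩,
    Real.artanh_injOn.eq_iff _ ⟨by linarith [norm_nonneg q], hq'⟩, div_eq_iff hden.ne']
  · constructor <;> intro h <;> linarith
  · rw [Set.mem_Ioo, lt_div_iff₀ hden, div_lt_one hden]
    constructor <;> nlinarith [norm_nonneg z]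

lemma rho_mul_eq_norm_sub_norm_iff (hz : z ∈ ball n) (hq : q ∈ ball n) :
    rho z q * (1 - ‖z‖ * ‖q‖) = ‖q‖ - ‖z‖ ↔
      ‖z‖ ≤ ‖q‖ ∧ ‖(1 - inner ℂ z q : ℂ)‖ = 1 - ‖z‖ * ‖q‖ := by
  have hpos : 0 < 1 - ‖z‖ * ‖q‖ := sub_pos.2 (norm_mul_norm_lt_one hz hq)
  have hrho : 0 < 1 - rho z q ^ 2 := by nlinarith [(rho_mem_Ioo hz hq).1, (rho_mem_Ioo hz hq).2]
  have hid := one_sub_rho_sq hz hq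
  have hlagrange : (1 - ‖z‖ ^ 2) * (1 - ‖q‖ ^ 2) = (1 - ‖z‖ * ‖q‖) ^ 2 - (‖q‖ - ‖z‖) ^ 2 := by ring
  constructor
  · intro h
    refine ⟨by nlinarith [rho_nonneg z q], ?_⟩
    rw [hlagrange, ← h] at hid
    refine (pow_left_inj₀ (norm_nonneg _) hpos.le two_ne_zero).1 (mul_left_cancel₀ hrho.ne' ?_)
    linear_combination hid
  · rintro ⟨hle, h⟩
    rw [h, hlagrange] at hid
    refine (pow_left_inj₀ (mul_nonneg (rho_nonneg z q) hpos.le) (sub_nonneg.2 hle) two_ne_zero).1 ?_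
    linear_combination -hid

lemma norm_one_sub_inner_eq_iff (hz : z ∈ ball n) (hq : q ∈ ball n) :
    ‖(1 - inner ℂ z q : ℂ)‖ = 1 - ‖z‖ * ‖q‖ ↔ (inner ℂ z q : ℂ) = ‖z‖ * ‖q‖ := by
  constructor
  · intro h
    have hre : ‖z‖ * ‖q‖ ≤ (inner ℂ z q : ℂ).re := by
      have := Complex.re_le_norm (1 - inner ℂ z q : ℂ)
      rw [h, Complex.sub_re, Complex.one_re] at this
      linarith
    have hnorm : ‖(inner ℂ z q : ℂ)‖ = (inner ℂ z q : ℂ).re :=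
      le_antisymm ((norm_inner_le_norm z q).trans hre) (Complex.re_le_norm _)
    have hreal : (inner ℂ z q : ℂ) = ((inner ℂ z q : ℂ).re : ℂ) :=
      Complex.eq_re_of_ofReal_le (r := 0) (Complex.re_eq_norm.1 hnorm.symm)
    rw [hreal, ← hnorm, ← Complex.ofReal_mul, Complex.ofReal_inj]
    exact le_antisymm (norm_inner_le_norm z q) (hnorm ▸ hre)
  · intro h
    rw [h, ← Complex.ofReal_mul, ← Complex.ofReal_one, ← Complex.ofReal_sub, Complex.norm_real,
      Real.norm_of_nonneg (sub_nonneg.2 (norm_mul_norm_lt_one hz hq).le)]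

lemma norm_ofReal_smul {t : ℝ} (ht : 0 ≤ t) (q : Cn n) : ‖(t : ℂ) • q‖ = t * ‖q‖ := by
  rw [norm_smul, Complex.norm_real, Real.norm_of_nonneg ht]

lemma ofReal_smul_mem_ball (hq : q ∈ ball n) {t : ℝ} (ht : t ∈ Set.Icc (0 : ℝ) 1) :
    (t : ℂ) • q ∈ ball n := by
  have := mem_ball_iff.1 hq
  rw [mem_ball_iff, norm_ofReal_smul ht.1]
  nlinarith [norm_nonneg q, ht.2]

lemma inner_eq_norm_mul_norm_and_norm_le_iff :
    (‖z‖ ≤ ‖q‖ ∧ (inner ℂ z q : ℂ) = ‖z‖ * ‖q‖) ↔ ∃ t ∈ Set.Icc (0 : ℝ) 1, z = (t : ℂ) • q := by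
  have hcollinear : (inner ℂ z q : ℂ) = ‖z‖ * ‖q‖ ↔ (‖q‖ : ℂ) • z = (‖z‖ : ℂ) • q :=
    inner_eq_norm_mul_iff
  rw [hcollinear]
  constructor
  · rintro ⟨hle, h⟩
    refine ⟨‖z‖ / ‖q‖, ⟨by positivity, div_le_one_of_le₀ hle (norm_nonneg q)⟩, ?_⟩
    rcases eq_or_ne q 0 with rfl | hq
    · simpa using hle
    · have hq' : (‖q‖ : ℂ) ≠ 0 := by exact_mod_cast norm_ne_zero_iff.2 hq
      rw [Complex.ofReal_div, div_eq_inv_mul, mul_smul, ← h, smul_smul, inv_mul_cancel₀ hq',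
        one_smul]
  · rintro ⟨t, ⟨ht₀, ht₁⟩, rfl⟩
    rw [norm_ofReal_smul ht₀, smul_smul, Complex.ofReal_mul, mul_comm (‖q‖ : ℂ)]
    exact ⟨mul_le_of_le_one_left (norm_nonneg q) ht₁, rfl⟩

lemma mem_geodesicSegment_zero_iff (hq : q ∈ ball n) :
    z ∈ geodesicSegment 0 q ↔ ∃ t ∈ Set.Icc (0 : ℝ) 1, z = (t : ℂ) • q := by
  rw [← inner_eq_norm_mul_norm_and_norm_le_iff]
  have hbetween (hz : z ∈ ball n) : beta 0 z + beta z q = beta 0 q ↔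
      ‖z‖ ≤ ‖q‖ ∧ (inner ℂ z q : ℂ) = ‖z‖ * ‖q‖ := by
    rw [beta_zero_add_beta_eq_iff hz hq, rho_mul_eq_norm_sub_norm_iff hz hq,
      norm_one_sub_inner_eq_iff hz hq]
  refine ⟨fun h => (hbetween h.1).1 h.2, fun h => ?_⟩
  have hz : z ∈ ball n := mem_ball_iff.2 (h.1.trans_lt (mem_ball_iff.1 hq))
  exact ⟨hz, (hbetween hz).2 h⟩

lemma act_mem_geodesicSegment (T : unitaryGroup n) (hp : p ∈ ball n) (hq : q ∈ ball n)
    (h : z ∈ geodesicSegment p q) : act T z ∈ geodesicSegment (act T p) (act T q) := by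
  refine ⟨act_mem_ball T h.1, ?_⟩
  rw [beta_act T hp h.1, beta_act T h.1 hq, beta_act T hp hq, h.2]

lemma act_mem_solidTriangle (T : unitaryGroup n) {a b c : Cn n} (ha : a ∈ ball n)
    (hb : b ∈ ball n) (hc : c ∈ ball n) (h : z ∈ solidTriangle a b c) :
    act T z ∈ solidTriangle (act T a) (act T b) (act T c) := by
  obtain ⟨w, hw, hz⟩ := h
  exact ⟨act T w, act_mem_geodesicSegment T hb hc hw, act_mem_geodesicSegment T ha hw.1 hz⟩

lemma act_mem_solidTriangle_iff (T : unitaryGroup n) {a b c : Cn n} (ha : a ∈ ball n)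
    (hb : b ∈ ball n) (hc : c ∈ ball n) (hz : z ∈ ball n) :
    act T z ∈ solidTriangle (act T a) (act T b) (act T c) ↔ z ∈ solidTriangle a b c := by
  refine ⟨fun h => ?_, act_mem_solidTriangle T ha hb hc⟩
  simpa only [act_inv_act T ha, act_inv_act T hb, act_inv_act T hc, act_inv_act T hz] using
    act_mem_solidTriangle T⁻¹ (act_mem_ball T ha) (act_mem_ball T hb) (act_mem_ball T hc) h

/-- A parametrization by `[0, 1]` of the geodesic segment from `p` to `q`, transported by the
exchange of `0` and `p` from the radial segment that starts at `0`. -/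
def segmentPath (p q : Cn n) (t : ℝ) : Cn n :=
  act (exchange p) ((t : ℂ) • act (exchange p) q)

lemma segmentPath_zero (hp : p ∈ ball n) (q : Cn n) : segmentPath p q 0 = p := by
  simp [segmentPath, act_exchange_zero hp]

lemma segmentPath_one (hq : q ∈ ball n) : segmentPath p q 1 = q := by
  simp [segmentPath, act_exchange_act_exchange hq]

lemma act_exchange_zero_left (z : Cn n) : act (exchange 0) z = -z := by
  simp [act_exchange zero_mem_ball]

lemma segmentPath_zero_left (q : Cn n) (t : ℝ) : segmentPath 0 q t = (t : ℂ) • q := by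
  simp [segmentPath, act_exchange_zero_left]

lemma mem_geodesicSegment_iff (hp : p ∈ ball n) (hq : q ∈ ball n) :
    z ∈ geodesicSegment p q ↔ ∃ t ∈ Set.Icc (0 : ℝ) 1, z = segmentPath p q t := by
  have hq' := act_mem_ball (exchange p) hq
  constructor
  · intro h
    have h' := act_mem_geodesicSegment (exchange p) hp hq h
    rw [act_exchange_self hp, mem_geodesicSegment_zero_iff hq'] at h'
    obtain ⟨t, ht, hzt⟩ := h'
    exact ⟨t, ht, by rw [segmentPath, ← hzt, act_exchange_act_exchange h.1]⟩
  · rintro ⟨t, ht, rfl⟩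
    have h' := act_mem_geodesicSegment (exchange p) zero_mem_ball hq'
      ((mem_geodesicSegment_zero_iff hq').2 ⟨t, ht, rfl⟩)
    rwa [act_exchange_zero hp, act_exchange_act_exchange hq] at h'

lemma segmentPath_mem_geodesicSegment (hp : p ∈ ball n) (hq : q ∈ ball n) {t : ℝ}
    (ht : t ∈ Set.Icc (0 : ℝ) 1) : segmentPath p q t ∈ geodesicSegment p q :=
  (mem_geodesicSegment_iff hp hq).2 ⟨t, ht, rfl⟩

lemma left_mem_geodesicSegment (hp : p ∈ ball n) (hq : q ∈ ball n) : p ∈ geodesicSegment p q := by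
  simpa [segmentPath_zero hp] using
    segmentPath_mem_geodesicSegment hp hq (Set.left_mem_Icc.2 zero_le_one)

lemma right_mem_geodesicSegment (hp : p ∈ ball n) (hq : q ∈ ball n) :
    q ∈ geodesicSegment p q := by
  simpa [segmentPath_one hq] using
    segmentPath_mem_geodesicSegment hp hq (Set.right_mem_Icc.2 zero_le_one)

lemma angularInvariant_eq_zero_of_mem_geodesicSegment (hp : p ∈ ball n) (hq : q ∈ ball n)
    (hz : z ∈ geodesicSegment p q) (hw : w ∈ geodesicSegment p q) :
    angularInvariant p z w = 0 := by
  have hq' := act_mem_ball (exchange p) hq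
  have hz' := act_mem_geodesicSegment (exchange p) hp hq hz
  have hw' := act_mem_geodesicSegment (exchange p) hp hq hw
  have hre := one_sub_inner_re_pos hz'.1 hw'.1
  rw [← angularInvariant_act (exchange p) hp hz.1 hw.1]
  rw [act_exchange_self hp] at hz' hw' ⊢
  obtain ⟨s, -, hs⟩ := (mem_geodesicSegment_zero_iff hq').1 hz'
  obtain ⟨t, -, ht⟩ := (mem_geodesicSegment_zero_iff hq').1 hw'
  rw [hs, ht, inner_smul_left, inner_smul_right, inner_self_ofReal, Complex.conj_ofReal,
    ← Complex.ofReal_mul, ← Complex.ofReal_mul, ← Complex.ofReal_one, ← Complex.ofReal_sub,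
    Complex.ofReal_re] at hre
  rw [angularInvariant_zero_left, kernel, hs, ht, inner_smul_left, inner_smul_right,
    inner_self_ofReal, Complex.conj_ofReal, ← Complex.ofReal_mul, ← Complex.ofReal_mul,
    ← Complex.ofReal_one, ← Complex.ofReal_sub, ← Complex.ofReal_div]
  exact Complex.arg_ofReal_of_nonneg (one_div_pos.2 hre).le

end segment

/-! ### Stokes' theorem on the square -/

lemma square_eq_Icc : square = Set.Icc ((0 : ℝ), (0 : ℝ)) (1, 1) := by
  rw [Set.Icc_prod_eq]
  rfl

lemma isCompact_square : IsCompact square := isCompact_Icc.prod isCompact_Icc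

lemma uniqueDiffOn_square : UniqueDiffOn ℝ square :=
  (uniqueDiffOn_Icc zero_lt_one).prod (uniqueDiffOn_Icc zero_lt_one)

/-- The open unit square, the interior of `square`. -/
def openSquare : Set (ℝ × ℝ) := Set.Ioo 0 1 ×ˢ Set.Ioo 0 1

lemma isOpen_openSquare : IsOpen openSquare := isOpen_Ioo.prod isOpen_Ioo

lemma openSquare_subset : openSquare ⊆ square :=
  Set.prod_mono Set.Ioo_subset_Icc_self Set.Ioo_subset_Icc_self

lemma openSquare_ae_eq : openSquare =ᵐ[MeasureTheory.volume] square :=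
  MeasureTheory.Measure.set_prod_ae_eq MeasureTheory.Ioo_ae_eq_Icc MeasureTheory.Ioo_ae_eq_Icc

lemma square_mem_nhds {p : ℝ × ℝ} (hp : p ∈ openSquare) : square ∈ nhds p :=
  Filter.mem_of_superset (isOpen_openSquare.mem_nhds hp) openSquare_subset

section stokes

variable {E : Type*} [NormedAddCommGroup E] [NormedSpace ℝ E]

/-- The exterior derivative `dα` of a one-form `α`, evaluated at the point `z` on the tangent
vectors `u, v`. -/
def dOneForm (α : E → E →L[ℝ] ℝ) (z u v : E) : ℝ := fderiv ℝ α z u v - fderiv ℝ α z v u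

/-- The integral of a one-form along a path parametrized by `[0, 1]`. -/
def lineIntegral (α : E → E →L[ℝ] ℝ) (γ : ℝ → E) : ℝ :=
  ∫ t in (0 : ℝ)..1, α (γ t) (derivWithin γ (Set.Icc 0 1) t)

lemma integral_square_dOneForm {β : ℝ × ℝ → ℝ × ℝ →L[ℝ] ℝ} (hβ : ContinuousOn β square)
    (hdiff : ∀ p ∈ openSquare, DifferentiableAt ℝ β p)
    (hint : MeasureTheory.IntegrableOn (fun p => dOneForm β p (1, 0) (0, 1)) square) :
    ∫ p in square, dOneForm β p (1, 0) (0, 1) =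
      (∫ s in (0 : ℝ)..1, β (s, 0) (1, 0)) + (∫ t in (0 : ℝ)..1, β (1, t) (0, 1))
        - (∫ s in (0 : ℝ)..1, β (s, 1) (1, 0)) - ∫ t in (0 : ℝ)..1, β (0, t) (0, 1) := by
  have hcont (v : ℝ × ℝ) : ContinuousOn (fun p => β p v) square := hβ.clm_apply continuousOn_const
  have hderiv (v : ℝ × ℝ) : ∀ p ∈ openSquare,
      HasFDerivAt (fun p => β p v) ((fderiv ℝ β p).flip v) p := fun p hp => by
    simpa using (hdiff p hp).hasFDerivAt.clm_apply (hasFDerivAt_const v p)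
  have hdiv (p : ℝ × ℝ) : (fderiv ℝ β p).flip (0, 1) (1, 0) + (-(fderiv ℝ β p).flip (1, 0)) (0, 1)
      = dOneForm β p (1, 0) (0, 1) := rfl
  have hdivergence := MeasureTheory.integral_divergence_prod_Icc_of_hasFDerivAt_of_le
    (fun p => β p (0, 1)) (fun p => -β p (1, 0)) _ _ (0, 0) (1, 1) (by simp)
    (square_eq_Icc ▸ hcont _) (square_eq_Icc ▸ (hcont _).neg) (hderiv _)
    (fun p hp => (hderiv (1, 0) p hp).neg) (by simpa only [hdiv, ← square_eq_Icc] using hint)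
  simp only [hdiv, ← square_eq_Icc, intervalIntegral.integral_neg] at hdivergence
  rw [hdivergence]
  ring

variable {U : Set E} {α : E → E →L[ℝ] ℝ} {σ : ℝ × ℝ → E}

lemma hasFDerivAt_of_mem_openSquare (hσ : ContDiffOn ℝ 2 σ square) {p : ℝ × ℝ}
    (hp : p ∈ openSquare) : HasFDerivAt σ (fderivWithin ℝ σ square p) p := by
  rw [fderivWithin_of_mem_nhds (square_mem_nhds hp)]
  exact ((hσ.contDiffAt (square_mem_nhds hp)).differentiableAt (by simp)).hasFDerivAt

lemma hasFDerivAt_fderivWithin_square (hσ : ContDiffOn ℝ 2 σ square) {p : ℝ × ℝ}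
    (hp : p ∈ openSquare) :
    HasFDerivAt (fderivWithin ℝ σ square) (fderiv ℝ (fderiv ℝ σ) p) p := by
  have hD : fderivWithin ℝ σ square =ᶠ[nhds p] fderiv ℝ σ := by
    filter_upwards [isOpen_openSquare.mem_nhds hp] with x hx
    exact fderivWithin_of_mem_nhds (square_mem_nhds hx)
  have hdiff : DifferentiableAt ℝ (fderiv ℝ σ) p :=
    ((hσ.contDiffAt (square_mem_nhds hp)).fderiv_right (m := 1)
      (by norm_num)).differentiableAt (by simp)
  exact hdiff.hasFDerivAt.congr_of_eventuallyEq hD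

/-- Naturality of the exterior derivative: the second derivatives of `σ` cancel by symmetry. -/
lemma dOneForm_pullback (hσ : ContDiffOn ℝ 2 σ square) {p : ℝ × ℝ} (hp : p ∈ openSquare)
    (hα : DifferentiableAt ℝ α (σ p)) :
    DifferentiableAt ℝ (fun p => (α (σ p)).comp (fderivWithin ℝ σ square p)) p ∧
      ∀ u v, dOneForm (fun p => (α (σ p)).comp (fderivWithin ℝ σ square p)) p u v =
        dOneForm α (σ p) (fderivWithin ℝ σ square p u) (fderivWithin ℝ σ square p v) := by
  have hcomp : HasFDerivAt (fun p => α (σ p)) _ p :=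
    hα.hasFDerivAt.comp p (hasFDerivAt_of_mem_openSquare hσ hp)
  have hpull := hcomp.clm_comp (hasFDerivAt_fderivWithin_square hσ hp)
  refine ⟨hpull.differentiableAt, fun u v => ?_⟩
  have hsymm := ((hσ.contDiffAt (square_mem_nhds hp)).isSymmSndFDerivAt (by simp)).eq u v
  rw [dOneForm, hpull.fderiv, dOneForm]
  simp [hsymm]

lemma derivWithin_horizontal (hσ : DifferentiableOn ℝ σ square) {s t : ℝ}
    (hs : s ∈ Set.Icc (0 : ℝ) 1) (ht : t ∈ Set.Icc (0 : ℝ) 1) :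
    derivWithin (fun s => σ (s, t)) (Set.Icc 0 1) s = fderivWithin ℝ σ square (s, t) (1, 0) :=
  (((hσ (s, t) ⟨hs, ht⟩).hasFDerivWithinAt).comp_hasDerivWithinAt (f := fun x : ℝ => (x, t)) s
    ((hasDerivAt_id s).prodMk (hasDerivAt_const s t)).hasDerivWithinAt
    fun _ hx => ⟨hx, ht⟩).derivWithin (uniqueDiffOn_Icc zero_lt_one s hs)

lemma derivWithin_vertical (hσ : DifferentiableOn ℝ σ square) {s t : ℝ}
    (hs : s ∈ Set.Icc (0 : ℝ) 1) (ht : t ∈ Set.Icc (0 : ℝ) 1) :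
    derivWithin (fun t => σ (s, t)) (Set.Icc 0 1) t = fderivWithin ℝ σ square (s, t) (0, 1) :=
  (((hσ (s, t) ⟨hs, ht⟩).hasFDerivWithinAt).comp_hasDerivWithinAt (f := fun x : ℝ => (s, x)) t
    ((hasDerivAt_const t s).prodMk (hasDerivAt_id t)).hasDerivWithinAt
    fun _ hx => ⟨hs, hx⟩).derivWithin (uniqueDiffOn_Icc zero_lt_one t ht)

lemma continuousOn_dOneForm (hU : IsOpen U) (hα : ContDiffOn ℝ 1 α U)
    (hσ : ContDiffOn ℝ 2 σ square) (hmaps : Set.MapsTo σ square U) :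
    ContinuousOn (fun p => dOneForm α (σ p) (fderivWithin ℝ σ square p (1, 0))
      (fderivWithin ℝ σ square p (0, 1))) square := by
  have hdα : ContinuousOn (fun p => fderiv ℝ α (σ p)) square :=
    (hα.continuousOn_fderiv_of_isOpen hU le_rfl).comp hσ.continuousOn hmaps
  have hdσ (v : ℝ × ℝ) : ContinuousOn (fun p => fderivWithin ℝ σ square p v) square :=
    (hσ.continuousOn_fderivWithin uniqueDiffOn_square (by simp)).clm_apply continuousOn_const
  exact ((hdα.clm_apply (hdσ _)).clm_apply (hdσ _)).sub ((hdα.clm_apply (hdσ _)).clm_apply (hdσ _))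

lemma integral_dOneForm_eq_lineIntegral (hU : IsOpen U) (hα : ContDiffOn ℝ 1 α U)
    (hσ : ContDiffOn ℝ 2 σ square) (hmaps : Set.MapsTo σ square U) :
    ∫ p in square, dOneForm α (σ p) (fderivWithin ℝ σ square p (1, 0))
        (fderivWithin ℝ σ square p (0, 1)) =
      lineIntegral α (fun s => σ (s, 0)) + lineIntegral α (fun t => σ (1, t))
        - lineIntegral α (fun s => σ (s, 1)) - lineIntegral α (fun t => σ (0, t)) := by
  have hσd : DifferentiableOn ℝ σ square := hσ.differentiableOn (by simp)
  have hpull (p) (hp : p ∈ openSquare) := dOneForm_pullback hσ hp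
    ((hα.contDiffAt (hU.mem_nhds (hmaps (openSquare_subset hp)))).differentiableAt one_ne_zero)
  have hcont : ContinuousOn (fun p => (α (σ p)).comp (fderivWithin ℝ σ square p)) square :=
    (hα.continuousOn.comp hσ.continuousOn hmaps).clm_comp
      (hσ.continuousOn_fderivWithin uniqueDiffOn_square (by simp))
  have hint := (((continuousOn_dOneForm hU hα hσ hmaps).integrableOn_compact
    (μ := MeasureTheory.volume) isCompact_square).mono_set openSquare_subset).congr_fun
    (fun p hp => ((hpull p hp).2 (1, 0) (0, 1)).symm) isOpen_openSquare.measurableSet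
  have hgreen := integral_square_dOneForm hcont (fun p hp => (hpull p hp).1)
    ((MeasureTheory.integrableOn_congr_set_ae openSquare_ae_eq).1 hint)
  rw [← MeasureTheory.setIntegral_congr_set openSquare_ae_eq,
    MeasureTheory.setIntegral_congr_fun isOpen_openSquare.measurableSet
      (fun p hp => (hpull p hp).2 (1, 0) (0, 1)),
    MeasureTheory.setIntegral_congr_set openSquare_ae_eq] at hgreen
  have hedge {f g : ℝ → ℝ} (h : ∀ t ∈ Set.Icc (0 : ℝ) 1, f t = g t) :
      ∫ t in (0 : ℝ)..1, f t = ∫ t in (0 : ℝ)..1, g t :=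
    intervalIntegral.integral_congr (by rwa [Set.uIcc_of_le zero_le_one])
  have h₀ : (0 : ℝ) ∈ Set.Icc (0 : ℝ) 1 := Set.left_mem_Icc.2 zero_le_one
  have h₁ : (1 : ℝ) ∈ Set.Icc (0 : ℝ) 1 := Set.right_mem_Icc.2 zero_le_one
  rw [hgreen]
  unfold lineIntegral
  refine congrArg₂ _ (congrArg₂ _ (congrArg₂ _ ?_ ?_) ?_) ?_
  · exact hedge fun s hs => by rw [derivWithin_horizontal hσd hs h₀]; rfl
  · exact hedge fun t ht => by rw [derivWithin_vertical hσd h₁ ht]; rfl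
  · exact hedge fun s hs => by rw [derivWithin_horizontal hσd hs h₁]; rfl
  · exact hedge fun t ht => by rw [derivWithin_vertical hσd h₀ ht]; rfl

end stokes

/-! ### Symplectic area -/

/-- The Hermitian product of `ℂ^n` as a real bilinear map. -/
def innerBilin (n : ℕ) : Cn n →L[ℝ] Cn n →L[ℝ] ℂ :=
  (isBoundedBilinearMap_inner (𝕜 := ℂ) (E := Cn n)).toContinuousLinearMap

/-- The imaginary part of the Hermitian product of `ℂ^n`, as a real bilinear map. -/
def imInner (n : ℕ) : Cn n →L[ℝ] Cn n →L[ℝ] ℝ :=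
  (ContinuousLinearMap.compL ℝ (Cn n) ℂ ℝ Complex.imCLM).comp (innerBilin n)

lemma innerBilin_apply (z u : Cn n) : innerBilin n z u = inner ℂ z u := rfl

lemma imInner_apply (z u : Cn n) : imInner n z u = (inner ℂ z u : ℂ).im := rfl

/-- The primitive `2 Im⟨z,u⟩ / (1-|z|²)` of the symplectic form. It vanishes along the radii of
the ball. -/
def eta (z : Cn n) : Cn n →L[ℝ] ℝ := (2 * (1 - ‖z‖ ^ 2)⁻¹) • imInner n z

lemma contDiffOn_eta : ContDiffOn ℝ 1 (eta : Cn n → Cn n →L[ℝ] ℝ) (ball n) :=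
  (contDiffOn_const.mul ((contDiffOn_const.sub (contDiff_norm_sq ℂ).contDiffOn).inv
    fun _ hz => (one_sub_norm_sq_pos hz).ne')).smul (imInner n).contDiff.contDiffOn

lemma hasFDerivAt_norm_sq (z : Cn n) :
    HasFDerivAt (fun z : Cn n => ‖z‖ ^ 2) ((2 : ℝ) • Complex.reCLM.comp (innerBilin n z)) z := by
  have hinner := Complex.reCLM.hasFDerivAt.comp z
    ((hasFDerivAt_id (𝕜 := ℝ) z).inner ℂ (hasFDerivAt_id z))
  refine (hinner.congr_of_eventuallyEq (.of_forall fun w => ?_)).congr_fderiv ?_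
  · change ‖w‖ ^ 2 = (inner ℂ w w : ℂ).re
    rw [inner_self_ofReal, Complex.ofReal_re]
  · ext u
    have hre : (inner ℂ u z : ℂ).re = (inner ℂ z u : ℂ).re := by
      rw [← inner_conj_symm, Complex.conj_re]
    simp [fderivInnerCLM_apply, innerBilin_apply, hre, two_mul]

lemma dOneForm_eta {z : Cn n} (hz : z ∈ ball n) (u v : Cn n) :
    dOneForm eta z u v = omega z u v := by
  have hN := (one_sub_norm_sq_pos hz).ne'
  have hcoeff := ((hasDerivAt_inv hN).comp_hasFDerivAt z
    ((hasFDerivAt_norm_sq z).const_sub 1)).const_mul 2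
  have heta : HasFDerivAt eta _ z := hcoeff.smul (imInner n).hasFDerivAt
  have hswap : (inner ℂ v u : ℂ).im = -(inner ℂ u v : ℂ).im := by
    rw [← inner_conj_symm, Complex.conj_im]
  have hconj : (inner ℂ u z : ℂ) = (starRingEnd ℂ) (inner ℂ z u) := (inner_conj_symm u z).symm
  rw [dOneForm, heta.fderiv, omega, hconj]
  simp [imInner_apply, innerBilin_apply, hswap, -inner_conj_symm]
  norm_cast
  field_simp
  ring

section lineIntegral

variable {p q : Cn n} {γ : ℝ → Cn n}

lemma lineIntegral_const {E : Type*} [NormedAddCommGroup E] [NormedSpace ℝ E]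
    {α : E → E →L[ℝ] ℝ} {γ : ℝ → E} {a : E} (hγ : ∀ t ∈ Set.Icc (0 : ℝ) 1, γ t = a) :
    lineIntegral α γ = 0 := by
  refine intervalIntegral.integral_zero_ae (.of_forall fun t ht => ?_)
  rw [Set.uIoc_of_le zero_le_one] at ht
  have ht' := Set.Ioc_subset_Icc_self ht
  rw [derivWithin_congr hγ (hγ t ht'), derivWithin_fun_const, Pi.zero_apply, map_zero]

lemma arg_kernel_eq_neg_im_log (x y : Cn n) (hx : x ∈ ball n) (hy : y ∈ ball n) :
    (kernel x y).arg = -(Complex.log (1 - inner ℂ x y)).im := by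
  rw [kernel, one_div, Complex.log_im, Complex.arg_inv, if_neg]
  have h := (Complex.abs_arg_lt_pi_div_two_iff.2 (.inl (one_sub_inner_re_pos hx hy)))
  linarith [(abs_lt.1 h).2, Real.pi_pos]

lemma hasDerivAt_arg_kernel {γ' : Cn n} {s : ℝ} (hp : p ∈ ball n) (hγ : HasDerivAt γ γ' s)
    (hs : ∀ᶠ r in nhds s, γ r ∈ ball n) :
    HasDerivAt (fun r => (kernel p (γ r)).arg) (inner ℂ p γ' / (1 - inner ℂ p (γ s)) : ℂ).im s := by
  have hinner : HasDerivAt (fun r => (1 - inner ℂ p (γ r) : ℂ)) (-inner ℂ p γ') s :=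
    (((hasDerivAt_const s p).inner ℂ hγ).const_sub 1).congr_deriv (by simp)
  have hlog := (Complex.imCLM.hasFDerivAt.comp_hasDerivAt s
    (hinner.clog_real (.inl (one_sub_inner_re_pos hp hs.self_of_nhds)))).neg
  refine (hlog.congr_of_eventuallyEq ?_).congr_deriv (by simp [neg_div])
  filter_upwards [hs] with r hr using arg_kernel_eq_neg_im_log p (γ r) hp hr

lemma continuousOn_arg_kernel {s : Set ℝ} (hp : p ∈ ball n) (hγ : ContinuousOn γ s)
    (hs : ∀ r ∈ s, γ r ∈ ball n) : ContinuousOn (fun r => (kernel p (γ r)).arg) s := by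
  have hlog : ContinuousOn (fun r => Complex.log (1 - inner ℂ p (γ r))) s :=
    (continuousOn_const.sub (continuousOn_const.inner hγ)).clog
      fun r hr => .inl (one_sub_inner_re_pos hp (hs r hr))
  exact (Complex.continuous_im.comp_continuousOn hlog).neg.congr
    fun r hr => arg_kernel_eq_neg_im_log p (γ r) hp (hs r hr)

lemma arg_kernel_eq_sub_of_mem_geodesicSegment {z w : Cn n} (hp : p ∈ ball n) (hq : q ∈ ball n)
    (hz : z ∈ geodesicSegment p q) (hw : w ∈ geodesicSegment p q) :
    (kernel z w).arg = (kernel p w).arg - (kernel p z).arg := by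
  have h := angularInvariant_eq_zero_of_mem_geodesicSegment hp hq hz hw
  rw [angularInvariant_eq_sum_arg hp hz.1 hw.1, arg_kernel_swap hp hw.1] at h
  linarith

lemma arg_kernel_self (hp : p ∈ ball n) : (kernel p p).arg = 0 := by
  linarith [arg_kernel_swap hp hp]

/-- Along a geodesic segment the derivative of `arg (kernel p ·)` at `z` does not change when `p`
is replaced by `z` itself, where it is half of `eta z`. -/
lemma hasDerivAt_arg_kernel_of_mem_geodesicSegment {γ' : Cn n} {s : ℝ} (hp : p ∈ ball n)
    (hq : q ∈ ball n) (hγ : HasDerivAt γ γ' s) (hs : ∀ᶠ r in nhds s, γ r ∈ geodesicSegment p q) :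
    HasDerivAt (fun r => 2 * (kernel p (γ r)).arg) (eta (γ s) γ') s := by
  have hmem := hs.self_of_nhds
  have hself := hasDerivAt_arg_kernel hmem.1 hγ (hs.mono fun _ h => h.1)
  have hsum := ((hself.add_const (kernel p (γ s)).arg).const_mul 2).congr_of_eventuallyEq
    (f₁ := fun r => 2 * (kernel p (γ r)).arg) <| by
      filter_upwards [hs] with r hr
      rw [arg_kernel_eq_sub_of_mem_geodesicSegment hp hq hmem hr, sub_add_cancel]
  refine hsum.congr_deriv ?_
  rw [inner_self_ofReal, ← Complex.ofReal_one, ← Complex.ofReal_sub, Complex.div_ofReal_im, eta,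
    smul_apply, imInner_apply, smul_eq_mul]
  ring

lemma lineIntegral_eta_of_mem_geodesicSegment (hγ : ContDiffOn ℝ 1 γ (Set.Icc 0 1))
    (hp : p ∈ ball n) (hq : q ∈ ball n) (hmem : ∀ t ∈ Set.Icc (0 : ℝ) 1, γ t ∈ geodesicSegment p q)
    (h₀ : γ 0 = p) (h₁ : γ 1 = q) : lineIntegral eta γ = 2 * (kernel p q).arg := by
  have hball : ∀ t ∈ Set.Icc (0 : ℝ) 1, γ t ∈ ball n := fun t ht => (hmem t ht).1
  have hcont : ContinuousOn (fun r => 2 * (kernel p (γ r)).arg) (Set.Icc 0 1) :=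
    continuousOn_const.mul (continuousOn_arg_kernel hp hγ.continuousOn hball)
  have hderiv : ∀ t ∈ Set.Ioo (0 : ℝ) 1, HasDerivAt (fun r => 2 * (kernel p (γ r)).arg)
      (eta (γ t) (derivWithin γ (Set.Icc 0 1) t)) t := fun t ht => by
    have hnhds := Icc_mem_nhds ht.1 ht.2
    refine hasDerivAt_arg_kernel_of_mem_geodesicSegment hp hq ?_ (Filter.mem_of_superset hnhds hmem)
    exact (hγ.differentiableOn one_ne_zero t
      (Set.Ioo_subset_Icc_self ht)).hasDerivWithinAt.hasDerivAt hnhds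
  have hint : ContinuousOn (fun t => eta (γ t) (derivWithin γ (Set.Icc 0 1) t))
      (Set.uIcc (0 : ℝ) 1) := by
    rw [Set.uIcc_of_le zero_le_one]
    exact (contDiffOn_eta.continuousOn.comp hγ.continuousOn hball).clm_apply
      (hγ.continuousOn_derivWithin (uniqueDiffOn_Icc zero_lt_one) le_rfl)
  rw [lineIntegral, intervalIntegral.integral_eq_sub_of_hasDerivAt_of_le zero_le_one hcont
    hderiv hint.intervalIntegrable, h₀, h₁, arg_kernel_self hp]
  ring

end lineIntegral

section spanning

variable {a b c : Cn n}

lemma IsSpanningSurface.integralOmega_eq {σ : ℝ × ℝ → Cn n} (hσ : IsSpanningSurface a b c σ)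
    (ha : a ∈ ball n) (hb : b ∈ ball n) (hc : c ∈ ball n) :
    integralOmega σ = 2 * angularInvariant a b c := by
  have h₀ : (0 : ℝ) ∈ Set.Icc (0 : ℝ) 1 := Set.left_mem_Icc.2 zero_le_one
  have h₁ : (1 : ℝ) ∈ Set.Icc (0 : ℝ) 1 := Set.right_mem_Icc.2 zero_le_one
  have hhor {t : ℝ} (ht : t ∈ Set.Icc (0 : ℝ) 1) :
      ContDiffOn ℝ 1 (fun s => σ (s, t)) (Set.Icc 0 1) :=
    (hσ.smooth.of_le (by simp)).comp (contDiff_id.prodMk contDiff_const).contDiffOn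
      fun _ hs => ⟨hs, ht⟩
  have hver {s : ℝ} (hs : s ∈ Set.Icc (0 : ℝ) 1) :
      ContDiffOn ℝ 1 (fun t => σ (s, t)) (Set.Icc 0 1) :=
    (hσ.smooth.of_le (by simp)).comp (contDiff_const.prodMk contDiff_id).contDiffOn
      fun _ ht => ⟨hs, ht⟩
  have hstokes := integral_dOneForm_eq_lineIntegral Metric.isOpen_ball contDiffOn_eta
    (hσ.smooth.of_le ENat.LEInfty.out) hσ.mem_ball
  rw [MeasureTheory.setIntegral_congr_fun isCompact_square.measurableSet
    fun p hp => dOneForm_eta (hσ.mem_ball p hp) _ _] at hstokes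
  rw [integralOmega, hstokes, lineIntegral_const hσ.vertex_a,
    lineIntegral_eta_of_mem_geodesicSegment (hhor h₀) ha hb hσ.side_ab (hσ.vertex_a 0 h₀)
      hσ.vertex_b,
    lineIntegral_eta_of_mem_geodesicSegment (hver h₁) hb hc hσ.side_bc hσ.vertex_b hσ.vertex_c,
    lineIntegral_eta_of_mem_geodesicSegment (hhor h₁) ha hc hσ.side_ac (hσ.vertex_a 1 h₁)
      hσ.vertex_c,
    angularInvariant_eq_sum_arg ha hb hc, arg_kernel_swap ha hc]
  ring

lemma contDiffOn_act_exchange (hp : a ∈ ball n) : ContDiffOn ℝ ∞ (act (exchange a)) (ball n) := by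
  have hinner : ContDiff ℝ ∞ (fun z : Cn n => (inner ℂ a z : ℂ)) := (innerBilin n a).contDiff
  have hdenom : ContDiffOn ℝ ∞ (fun z : Cn n => (1 - inner ℂ a z : ℂ)⁻¹) (ball n) :=
    (contDiff_const.sub hinner).contDiffOn.inv fun z hz => one_sub_inner_ne_zero hp hz
  have hcoeff : ContDiff ℝ ∞ (fun z : Cn n => 1 - inner ℂ a z / (1 + (√(1 - ‖a‖ ^ 2) : ℂ))) :=
    contDiff_const.sub (hinner.div_const _)
  exact (hdenom.smul ((hcoeff.smul contDiff_const).sub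
    (contDiff_id.const_smul (√(1 - ‖a‖ ^ 2) : ℂ))).contDiffOn).congr fun z _ => act_exchange hp z

lemma contDiffOn_segmentPath {X : Type*} [NormedAddCommGroup X] [NormedSpace ℝ X] {s : Set X}
    {q : X → Cn n} {t : X → ℝ} (ha : a ∈ ball n) (hq : ContDiffOn ℝ ∞ q s)
    (ht : ContDiffOn ℝ ∞ t s) (hqs : ∀ x ∈ s, q x ∈ ball n)
    (hts : ∀ x ∈ s, t x ∈ Set.Icc (0 : ℝ) 1) :
    ContDiffOn ℝ ∞ (fun x => segmentPath a (q x) (t x)) s :=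
  (contDiffOn_act_exchange ha).comp
    ((Complex.ofRealCLM.contDiff.comp_contDiffOn ht).smul
      ((contDiffOn_act_exchange ha).comp hq hqs))
    fun x hx => ofReal_smul_mem_ball (act_mem_ball _ (hqs x hx)) (hts x hx)

lemma isSpanningSurface_segmentPath (ha : a ∈ ball n) (hb : b ∈ ball n) (hc : c ∈ ball n) :
    IsSpanningSurface a b c fun p => segmentPath a (segmentPath b c p.2) p.1 where
  smooth := contDiffOn_segmentPath ha
    (contDiffOn_segmentPath hb contDiffOn_const contDiffOn_snd (fun _ _ => hc) fun _ hp => hp.2)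
    contDiffOn_fst (fun _ hp => (segmentPath_mem_geodesicSegment hb hc hp.2).1) fun _ hp => hp.1
  mem_ball _ hp := (segmentPath_mem_geodesicSegment ha
    (segmentPath_mem_geodesicSegment hb hc hp.2).1 hp.1).1
  vertex_a _ _ := segmentPath_zero ha _
  vertex_b := by simp only [segmentPath_zero hb, segmentPath_one hb]
  vertex_c := by simp only [segmentPath_one hc]
  side_ab s hs := by
    simpa only [segmentPath_zero hb] using segmentPath_mem_geodesicSegment ha hb hs
  side_bc t ht := by
    have hmem := segmentPath_mem_geodesicSegment hb hc ht
    rwa [segmentPath_one hmem.1]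
  side_ac s hs := by
    simpa only [segmentPath_one hc] using segmentPath_mem_geodesicSegment ha hc hs

lemma hasSymplecticArea (ha : a ∈ ball n) (hb : b ∈ ball n) (hc : c ∈ ball n) :
    HasSymplecticArea a b c (2 * angularInvariant a b c) :=
  ⟨⟨_, isSpanningSurface_segmentPath ha hb hc⟩, fun _ hσ => hσ.integralOmega_eq ha hb hc⟩

end spanning

/-! ### Complex geodesics -/

/-- The embedding `ζ ↦ (ζ, 0, …, 0)` as a continuous linear map. -/
def axisCLM (n : ℕ) : ℂ →L[ℂ] Cn n :=
  LinearMap.toContinuousLinearMap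
    { toFun := axis n
      map_add' := fun ζ ξ => by
        ext k
        by_cases hk : (k : ℕ) = 0 <;> simp [axis, hk]
      map_smul' := fun c ζ => by
        ext k
        simp [axis] }

lemma axis_smul (c ζ : ℂ) : axis n (c * ζ) = c • axis n ζ := map_smul (axisCLM n) c ζ

lemma axis_sub (ζ ξ : ℂ) : axis n (ζ - ξ) = axis n ζ - axis n ξ := map_sub (axisCLM n) ζ ξ

lemma axis_zero : axis n 0 = 0 := map_zero (axisCLM n)

lemma mem_disk_iff {ζ : ℂ} : ζ ∈ disk ↔ ‖ζ‖ < 1 := by simp [disk]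

section axis

variable [NeZero n]

lemma axis_apply_zero (ζ : ℂ) : axis n ζ 0 = ζ := by simp [axis]

lemma axis_eq_single (ζ : ℂ) : axis n ζ = EuclideanSpace.single 0 ζ := by
  ext k
  rw [PiLp.single_apply]
  simp only [axis, Fin.ext_iff, Fin.val_zero]

lemma inner_axis_left (ζ : ℂ) (z : Cn n) :
    inner ℂ (axis n ζ) z = (starRingEnd ℂ) ζ * z 0 := by
  rw [axis_eq_single, EuclideanSpace.inner_single_left]

lemma inner_axis_right (z : Cn n) (ζ : ℂ) :
    inner ℂ z (axis n ζ) = ζ * (starRingEnd ℂ) (z 0) := by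
  rw [axis_eq_single, EuclideanSpace.inner_single_right]

lemma norm_axis (ζ : ℂ) : ‖axis n ζ‖ = ‖ζ‖ := by
  rw [axis_eq_single, PiLp.norm_single]

lemma axis_injective : Function.Injective (axis n) := fun ζ ξ h => by
  rw [← axis_apply_zero (n := n) ζ, h, axis_apply_zero]

lemma axis_mem_ball_iff {ζ : ℂ} : axis n ζ ∈ ball n ↔ ζ ∈ disk := by
  rw [mem_ball_iff, norm_axis, mem_disk_iff]

lemma apply_zero_mem_disk {z : Cn n} (hz : z ∈ ball n) : z 0 ∈ disk :=
  mem_disk_iff.2 ((PiLp.norm_apply_le z 0).trans_lt (mem_ball_iff.1 hz))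

end axis

/-- The involutive automorphism of the disk that exchanges `0` and `α`. -/
def mobius (α ζ : ℂ) : ℂ := (α - ζ) / (1 - (starRingEnd ℂ) α * ζ)

lemma act_exchange_axis [NeZero n] {α : ℂ} (hα : α ∈ disk) (ζ : ℂ) :
    act (exchange (axis n α)) (axis n ζ) = axis n (mobius α ζ) := by
  have hαb := axis_mem_ball_iff (n := n).2 hα
  have hs := sqrt_one_sub_norm_sq_pos hαb
  have hsq : (√(1 - ‖α‖ ^ 2) : ℂ) ^ 2 = 1 - (starRingEnd ℂ) α * α := by
    have := Real.sq_sqrt (one_sub_norm_sq_pos hαb).le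
    rw [norm_axis] at this
    rw [mul_comm, Complex.mul_conj, Complex.normSq_eq_norm_sq]
    exact_mod_cast this
  rw [norm_axis] at hs
  have hs1 : (1 + √(1 - ‖α‖ ^ 2) : ℂ) ≠ 0 := by
    exact_mod_cast (by positivity : 1 + √(1 - ‖α‖ ^ 2) ≠ 0)
  have hnum : (1 - (starRingEnd ℂ) α * ζ / (1 + √(1 - ‖α‖ ^ 2))) * α - √(1 - ‖α‖ ^ 2) * ζ
      = α - ζ := by
    field_simp
    linear_combination -ζ * hsq
  rw [act_exchange hαb, inner_axis_left, axis_apply_zero, norm_axis, ← axis_smul, ← axis_smul,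
    ← axis_sub, ← axis_smul, hnum, mobius, div_eq_inv_mul]

section slice

variable (T : unitaryGroup n)

/-- The complex geodesic that is the image of the disk `{(ζ, 0, …, 0) : |ζ| < 1}` under `T`. -/
def slice : Set (Cn n) := (fun ζ => act T (axis n ζ)) '' disk

lemma isComplexGeodesic_slice : IsComplexGeodesic (slice T) :=
  ⟨fun ζ => act T (axis n ζ), ⟨act T, ⟨T.1, T.2, fun _ _ => rfl⟩, fun _ _ => rfl⟩, rfl⟩

variable [NeZero n]

lemma IsDiskChart.exists_slice {ψ : ℂ → Cn n} {G : Set (Cn n)} (h : IsDiskChart ψ G) :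
    ∃ T : unitaryGroup n, Set.EqOn ψ (fun ζ => act T (axis n ζ)) disk ∧ G = slice T := by
  obtain ⟨⟨f, ⟨T, hT, hf⟩, hψ⟩, rfl⟩ := h
  have heq : Set.EqOn ψ (fun ζ => act ⟨T, hT⟩ (axis n ζ)) disk :=
    fun ζ hζ => (hψ ζ hζ).trans (hf _ (axis_mem_ball_iff.2 hζ))
  exact ⟨⟨T, hT⟩, heq, heq.image_eq⟩

lemma IsComplexGeodesic.exists_slice {G : Set (Cn n)} (h : IsComplexGeodesic G) :
    ∃ T : unitaryGroup n, G = slice T := by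
  obtain ⟨ψ, hψ⟩ := h
  obtain ⟨T, -, hT⟩ := hψ.exists_slice
  exact ⟨T, hT⟩

/-- The plane `ℂ × 0 × ⋯ × 0 × ℂ`, whose lines that meet the ball are the points of the standard
complex geodesic. -/
def axisPlane (n : ℕ) : Submodule ℂ (Cn n × ℂ) :=
  LinearMap.range ((axisCLM n).toLinearMap.prodMap LinearMap.id)

lemma finrank_map_axisPlane :
    Module.finrank ℂ ((axisPlane n).map T.1.toLinearMap) = 2 := by
  have hinj : Function.Injective ((axisCLM n).toLinearMap.prodMap (LinearMap.id : ℂ →ₗ[ℂ] ℂ)) :=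
    axis_injective.prodMap Function.injective_id
  rw [LinearEquiv.finrank_map_eq, axisPlane, LinearMap.finrank_range_of_inj hinj]
  simp

lemma mem_slice_iff {z : Cn n} :
    z ∈ slice T ↔ z ∈ ball n ∧ (z, (1 : ℂ)) ∈ (axisPlane n).map T.1.toLinearMap := by
  constructor
  · rintro ⟨ζ, hζ, rfl⟩
    have hζb := axis_mem_ball_iff (n := n).2 hζ
    refine ⟨act_mem_ball T hζb, (Submodule.smul_mem_iff _ (denom_ne_zero T hζb)).1 ?_⟩
    rw [← map_lift T hζb]
    exact Submodule.mem_map_of_mem ⟨(ζ, 1), rfl⟩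
  · rintro ⟨hz, _, ⟨⟨ζ, η⟩, rfl⟩, h⟩
    have hT : (T⁻¹).1 (z, 1) = (axis n ζ, η) := T.1.symm_apply_eq.2 h.symm
    have hact : act T⁻¹ z = axis n (η⁻¹ * ζ) := by rw [act, denom, hT, axis_smul]
    refine ⟨η⁻¹ * ζ, axis_mem_ball_iff.1 (hact ▸ act_mem_ball T⁻¹ hz), ?_⟩
    simp only [← hact, act_act_inv T hz]

lemma map_axisPlane_eq_span {p q : Cn n} (hp : p ∈ slice T) (hq : q ∈ slice T) (hpq : p ≠ q) :
    (axisPlane n).map T.1.toLinearMap = Submodule.span ℂ (Set.range ![(p, (1 : ℂ)), (q, 1)]) := by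
  have hli : LinearIndependent ℂ ![(p, (1 : ℂ)), (q, 1)] := by
    refine LinearIndependent.pair_iff.2 fun c d h => ?_
    obtain ⟨hfst, hsnd⟩ := Prod.ext_iff.1 h
    have hsum : c * 1 + d * 1 = 0 := hsnd
    have hd : d = -c := by linear_combination hsum
    have hsub : c • (p - q) = 0 := by
      rw [smul_sub, sub_eq_add_neg, ← neg_smul, ← hd]
      exact hfst
    have hc := (smul_eq_zero.1 hsub).resolve_right (sub_ne_zero.2 hpq)
    exact ⟨hc, by rw [hd, hc, neg_zero]⟩
  refine (Submodule.eq_of_le_of_finrank_eq (Submodule.span_le.2 ?_) ?_).symm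
  · rintro _ ⟨k, rfl⟩
    fin_cases k
    exacts [((mem_slice_iff T).1 hp).2, ((mem_slice_iff T).1 hq).2]
  · rw [finrank_span_eq_card hli, finrank_map_axisPlane, Fintype.card_fin]

lemma IsComplexGeodesic.eq_of_mem {G H : Set (Cn n)} (hG : IsComplexGeodesic G)
    (hH : IsComplexGeodesic H) {p q : Cn n} (hpq : p ≠ q) (hpG : p ∈ G) (hqG : q ∈ G)
    (hpH : p ∈ H) (hqH : q ∈ H) : G = H := by
  obtain ⟨S, rfl⟩ := hG.exists_slice
  obtain ⟨T, rfl⟩ := hH.exists_slice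
  ext z
  rw [mem_slice_iff, mem_slice_iff, map_axisPlane_eq_span S hpG hqG hpq,
    map_axisPlane_eq_span T hpH hqH hpq]

end slice

lemma exists_linearIsometryEquiv_axis [NeZero n] {q : Cn n} (hq : q ≠ 0) :
    ∃ U : Cn n ≃ₗᵢ[ℂ] Cn n, U (axis n ‖q‖) = q := by
  have hnorm : (‖q‖ : ℂ) ≠ 0 := by exact_mod_cast norm_ne_zero_iff.2 hq
  have hunit : ‖(‖q‖ : ℂ)⁻¹ • q‖ = 1 := by simp [norm_smul, hq]
  have horth : Orthonormal ℂ (({0} : Set (Fin n)).domRestrict fun _ => (‖q‖ : ℂ)⁻¹ • q) :=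
    ⟨fun _ => hunit, fun i j hij => (hij (Subsingleton.elim i j)).elim⟩
  obtain ⟨b, hb⟩ := horth.exists_orthonormalBasis_extension_of_card_eq (by simp)
  refine ⟨b.repr.symm, ?_⟩
  rw [← mul_one (‖q‖ : ℂ), axis_smul, axis_eq_single, map_smul, b.repr_symm_single,
    hb 0 rfl, smul_smul, mul_inv_cancel₀ hnorm, one_smul]

/-- The embedding of `U(n)` in `U(n,1)`. -/
def ofUnitary (U : Cn n ≃ₗᵢ[ℂ] Cn n) : unitaryGroup n :=
  ⟨U.toLinearEquiv.prodCongr (LinearEquiv.refl ℂ ℂ), fun X Y => by simp [form]⟩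

lemma act_ofUnitary (U : Cn n ≃ₗᵢ[ℂ] Cn n) (z : Cn n) : act (ofUnitary U) z = U z :=
  act_eq_of_lift one_ne_zero (by simp [ofUnitary])

lemma exists_mem_slice [NeZero n] {p q : Cn n} (hp : p ∈ ball n) (hq : q ∈ ball n)
    (hpq : p ≠ q) : ∃ T : unitaryGroup n, p ∈ slice T ∧ q ∈ slice T := by
  have hq' := act_mem_ball (exchange p) hq
  have hq'₀ : act (exchange p) q ≠ 0 := fun h => hpq <| by
    rw [← act_exchange_act_exchange (p := p) hq, h, act_exchange_zero hp]
  obtain ⟨U, hU⟩ := exists_linearIsometryEquiv_axis hq'₀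
  have hmem : (‖act (exchange p) q‖ : ℂ) ∈ disk := by
    simpa [mem_disk_iff] using mem_ball_iff.1 hq'
  refine ⟨exchange p * ofUnitary U, ⟨0, by simp [disk], ?_⟩, ⟨_, hmem, ?_⟩⟩
  · change act (exchange p * ofUnitary U) (axis n 0) = p
    rw [axis_zero, mul_act _ _ zero_mem_ball, act_ofUnitary, map_zero, act_exchange_zero hp]
  · change act (exchange p * ofUnitary U) (axis n _) = q
    rw [mul_act _ _ (axis_mem_ball_iff.2 hmem), act_ofUnitary, hU, act_exchange_act_exchange hq]

lemma mobius_mem_disk {α ζ : ℂ} (hα : α ∈ disk) (hζ : ζ ∈ disk) : mobius α ζ ∈ disk := by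
  rw [← axis_mem_ball_iff (n := 1), ← act_exchange_axis hα]
  exact act_mem_ball _ (axis_mem_ball_iff.2 hζ)

lemma ofReal_mul_mem_disk {ζ : ℂ} (hζ : ζ ∈ disk) {t : ℝ} (ht : t ∈ Set.Icc (0 : ℝ) 1) :
    (t : ℂ) * ζ ∈ disk := by
  rw [← axis_mem_ball_iff (n := 1), axis_smul]
  exact ofReal_smul_mem_ball (axis_mem_ball_iff.2 hζ) ht

lemma segmentPath_axis [NeZero n] {α : ℂ} (hα : α ∈ disk) (β : ℂ) (t : ℝ) :
    segmentPath (axis n α) (axis n β) t = axis n (mobius α (t * mobius α β)) := by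
  rw [segmentPath, act_exchange_axis hα, ← axis_smul, act_exchange_axis hα]

lemma geodesicSegment_subset_slice [NeZero n] {T : unitaryGroup n} {p q : Cn n}
    (hp : p ∈ slice T) (hq : q ∈ slice T) : geodesicSegment p q ⊆ slice T := by
  obtain ⟨α, hα, rfl⟩ := hp
  obtain ⟨β, hβ, rfl⟩ := hq
  have hαb := axis_mem_ball_iff (n := n).2 hα
  have hβb := axis_mem_ball_iff (n := n).2 hβ
  intro z hz
  have hz' := act_mem_geodesicSegment T⁻¹ (act_mem_ball T hαb) (act_mem_ball T hβb) hz
  rw [act_inv_act T hαb, act_inv_act T hβb, mem_geodesicSegment_iff hαb hβb] at hz'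
  obtain ⟨t, ht, htz⟩ := hz'
  rw [segmentPath_axis hα] at htz
  refine ⟨_, mobius_mem_disk hα (ofReal_mul_mem_disk (mobius_mem_disk hα hβ) ht), ?_⟩
  simp only [← htz, act_act_inv T hz.1]

lemma existsUnique_complexGeodesic [NeZero n] {p q : Cn n} (hp : p ∈ ball n) (hq : q ∈ ball n)
    (hpq : p ≠ q) : ∃! G : Set (Cn n), IsComplexGeodesic G ∧ geodesicSegment p q ⊆ G := by
  obtain ⟨T, hpT, hqT⟩ := exists_mem_slice hp hq hpq
  refine ⟨slice T, ⟨isComplexGeodesic_slice T, geodesicSegment_subset_slice hpT hqT⟩, ?_⟩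
  rintro G ⟨hG, hsub⟩
  exact hG.eq_of_mem (isComplexGeodesic_slice T) hpq
    (hsub (left_mem_geodesicSegment hp hq)) (hsub (right_mem_geodesicSegment hp hq)) hpT hqT

section nearestPoint

variable [NeZero n]

lemma one_sub_rho_axis_sq {y : Cn n} (hy : y ∈ ball n) {ξ : ℂ} (hξ : ξ ∈ disk) :
    (1 - rho y (axis n ξ) ^ 2) * (1 - ‖y 0‖ ^ 2) =
      (1 - ‖y‖ ^ 2) * (1 - rho (axis n (y 0)) (axis n ξ) ^ 2) := by
  have hξb := axis_mem_ball_iff (n := n).2 hξ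
  have hy₀b := axis_mem_ball_iff (n := n).2 (apply_zero_mem_disk hy)
  have h := one_sub_rho_sq hy hξb
  have h₀ := one_sub_rho_sq hy₀b hξb
  have hinner : (inner ℂ (axis n (y 0)) (axis n ξ) : ℂ) = inner ℂ y (axis n ξ) := by
    rw [inner_axis_right, inner_axis_right, axis_apply_zero]
  rw [hinner, norm_axis (y 0)] at h₀
  refine mul_right_cancel₀ (pow_ne_zero 2 (norm_ne_zero_iff.2 (one_sub_inner_ne_zero hy hξb))) ?_
  linear_combination (1 - ‖y 0‖ ^ 2) * h - (1 - ‖y‖ ^ 2) * h₀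

lemma rho_axis_lt {y : Cn n} (hy : y ∈ ball n) {ξ : ℂ} (hξ : ξ ∈ disk) (hne : ξ ≠ y 0) :
    rho y (axis n (y 0)) < rho y (axis n ξ) := by
  have hy₀ := apply_zero_mem_disk hy
  have hy₀b := axis_mem_ball_iff (n := n).2 hy₀
  have hξb := axis_mem_ball_iff (n := n).2 hξ
  have hfoot := one_sub_rho_axis_sq hy hy₀
  have hother := one_sub_rho_axis_sq hy hξ
  rw [(rho_eq_zero_iff hy₀b hy₀b).2 rfl] at hfoot
  have hpos : 0 < rho (axis n (y 0)) (axis n ξ) := (rho_nonneg _ _).lt_of_ne' fun h =>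
    hne (axis_injective ((rho_eq_zero_iff hy₀b hξb).1 h)).symm
  have hy₀pos := one_sub_norm_sq_pos hy₀b
  rw [norm_axis] at hy₀pos
  refine lt_of_pow_lt_pow_left₀ 2 (rho_nonneg _ _) (lt_of_mul_lt_mul_right ?_ hy₀pos.le)
  have hgap := mul_pos (one_sub_norm_sq_pos hy) (pow_pos hpos 2)
  linarith

/-- The coordinate, in the parametrization of `slice T` by the disk, of the point of `slice T`
nearest to `x`. -/
def footCoord (T : unitaryGroup n) (x : Cn n) : ℂ := act T⁻¹ x 0

lemma footCoord_mem_disk (T : unitaryGroup n) {x : Cn n} (hx : x ∈ ball n) :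
    footCoord T x ∈ disk :=
  apply_zero_mem_disk (act_mem_ball T⁻¹ hx)

lemma beta_footCoord_lt (T : unitaryGroup n) {x : Cn n} (hx : x ∈ ball n) {ξ : ℂ}
    (hξ : ξ ∈ disk) (hne : ξ ≠ footCoord T x) :
    beta x (act T (axis n (footCoord T x))) < beta x (act T (axis n ξ)) := by
  have hy := act_mem_ball T⁻¹ hx
  have hfoot := axis_mem_ball_iff (n := n).2 (footCoord_mem_disk T hx)
  have hξb := axis_mem_ball_iff (n := n).2 hξ
  have hbeta {w : Cn n} (hw : w ∈ ball n) : beta x (act T w) = beta (act T⁻¹ x) w := by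
    rw [← beta_act T hy hw, act_act_inv T hx]
  rw [hbeta hfoot, hbeta hξb, beta, beta,
    Real.artanh_lt_artanh_iff (rho_mem_Ioo hy hfoot) (rho_mem_Ioo hy hξb)]
  exact rho_axis_lt hy hξ hne

lemma isNearestPoint_slice_iff (T : unitaryGroup n) {x p : Cn n} (hx : x ∈ ball n) :
    IsNearestPoint (slice T) x p ↔ p = act T (axis n (footCoord T x)) := by
  have hfoot := footCoord_mem_disk T hx
  constructor
  · rintro ⟨⟨ξ, hξ, rfl⟩, hmin⟩
    by_contra hne
    have hξne : ξ ≠ footCoord T x := fun h => hne (by rw [h])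
    exact (hmin _ ⟨_, hfoot, rfl⟩).not_gt (beta_footCoord_lt T hx hξ hξne)
  · rintro rfl
    refine ⟨⟨_, hfoot, rfl⟩, ?_⟩
    rintro _ ⟨ξ, hξ, rfl⟩
    rcases eq_or_ne ξ (footCoord T x) with rfl | hne
    · exact le_rfl
    · exact (beta_footCoord_lt T hx hξ hne).le

end nearestPoint

/-! ### Areas in the disk -/

lemma omega_axis [NeZero n] (z u v : ℂ) : omega (axis n z) (axis n u) (axis n v) =
    ((starRingEnd ℂ) u * v).im * (4 / (1 - ‖z‖ ^ 2) ^ 2) := by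
  have hnum : ((1 - ‖z‖ ^ 2 : ℝ) : ℂ) * ((starRingEnd ℂ) u * v)
      + (starRingEnd ℂ) u * z * ((starRingEnd ℂ) z * v) = (starRingEnd ℂ) u * v := by
    push_cast
    linear_combination (starRingEnd ℂ) u * v * Complex.mul_conj' z
  rw [omega, inner_axis_left, inner_axis_left, inner_axis_left, axis_apply_zero, axis_apply_zero,
    norm_axis, hnum]
  ring

lemma det_comp_equivRealProdCLM (L : ℝ × ℝ →L[ℝ] ℂ) :
    (L.comp (Complex.equivRealProdCLM : ℂ →L[ℝ] ℝ × ℝ)).det =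
      ((starRingEnd ℂ) (L (1, 0)) * L (0, 1)).im := by
  rw [ContinuousLinearMap.det, ← LinearMap.det_toMatrix Complex.basisOneI, Matrix.det_fin_two]
  simp [LinearMap.toMatrix_apply]
  ring

/-- The Jacobian determinant at `p` of a map from the unit square to the plane. -/
def jacobian (F : ℝ × ℝ → ℂ) (p : ℝ × ℝ) : ℝ :=
  ((starRingEnd ℂ) (fderivWithin ℝ F square p (1, 0)) * fderivWithin ℝ F square p (0, 1)).im

section areaFormula

variable {F : ℝ × ℝ → ℂ}

lemma integralOmega_axis [NeZero n] (hF : ContDiffOn ℝ ∞ F square) :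
    integralOmega (fun p => axis n (F p)) =
      ∫ p in square, jacobian F p * (4 / (1 - ‖F p‖ ^ 2) ^ 2) := by
  refine MeasureTheory.setIntegral_congr_fun isCompact_square.measurableSet fun p hp => ?_
  have hderiv := ((axisCLM n).restrictScalars ℝ).hasFDerivAt.comp_hasFDerivWithinAt p
    (hF.differentiableOn (by simp) p hp).hasFDerivWithinAt
  have hfderiv : fderivWithin ℝ (fun p => axis n (F p)) square p = _ :=
    hderiv.fderivWithin (uniqueDiffOn_square p hp)
  simp only [hfderiv]
  exact omega_axis _ _ _

lemma continuousOn_jacobian (hF : ContDiffOn ℝ ∞ F square) : ContinuousOn (jacobian F) square := by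
  have hderiv (v : ℝ × ℝ) : ContinuousOn (fun p => fderivWithin ℝ F square p v) square :=
    (hF.continuousOn_fderivWithin uniqueDiffOn_square (by simp)).clm_apply continuousOn_const
  exact Complex.continuous_im.comp_continuousOn
    ((Complex.continuous_conj.comp_continuousOn (hderiv _)).mul (hderiv _))

lemma measurableSet_jacobian_ne_zero (hF : ContDiffOn ℝ ∞ F square) :
    MeasurableSet {p ∈ square | jacobian F p ≠ 0} := by
  have hzero : IsClosed (square ∩ jacobian F ⁻¹' {0}) :=
    (continuousOn_jacobian hF).preimage_isClosed_of_isClosed isCompact_square.isClosed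
      isClosed_singleton
  convert isCompact_square.measurableSet.diff hzero.measurableSet using 1
  ext p
  simp

lemma hasFDerivWithinAt_comp_equivRealProdCLM (hF : ContDiffOn ℝ ∞ F square) {S : Set (ℝ × ℝ)}
    (hS : S ⊆ square) {ξ : ℂ} (hξ : Complex.equivRealProdCLM ξ ∈ S) :
    HasFDerivWithinAt (fun ξ => F (Complex.equivRealProdCLM ξ))
      ((fderivWithin ℝ F square (Complex.equivRealProdCLM ξ)).comp
        (Complex.equivRealProdCLM : ℂ →L[ℝ] ℝ × ℝ)) (Complex.equivRealProdCLM ⁻¹' S) ξ :=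
  ((hF.differentiableOn (by simp) _ (hS hξ)).hasFDerivWithinAt.mono hS).comp ξ
    Complex.equivRealProdCLM.hasFDerivWithinAt (Set.mapsTo_preimage _ _)

lemma image_comp_equivRealProdCLM (S : Set (ℝ × ℝ)) :
    (fun ξ => F (Complex.equivRealProdCLM ξ)) '' (Complex.equivRealProdCLM ⁻¹' S) = F '' S := by
  rw [← Set.image_image F, Set.image_preimage_eq S Complex.equivRealProdCLM.surjective]

lemma volume_image_jacobian_eq_zero (hF : ContDiffOn ℝ ∞ F square) :
    MeasureTheory.volume (F '' {p ∈ square | jacobian F p = 0}) = 0 := by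
  rw [← image_comp_equivRealProdCLM]
  refine MeasureTheory.addHaar_image_eq_zero_of_det_fderivWithin_eq_zero _
    (fun ξ hξ => hasFDerivWithinAt_comp_equivRealProdCLM hF (Set.sep_subset _ _) hξ)
    fun ξ hξ => ?_
  rw [det_comp_equivRealProdCLM]
  exact hξ.2

lemma hypArea_image (hF : ContDiffOn ℝ ∞ F square) {S : Set (ℝ × ℝ)} (hS : MeasurableSet S)
    (hSsq : S ⊆ square) (hinj : Set.InjOn F S) :
    hypArea (F '' S) =
      ∫⁻ p in S, ENNReal.ofReal (|jacobian F p| * (4 / (1 - ‖F p‖ ^ 2) ^ 2)) := by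
  have hinj' : Set.InjOn (fun ξ => F (Complex.equivRealProdCLM ξ))
      (Complex.equivRealProdCLM ⁻¹' S) :=
    hinj.comp Complex.equivRealProdCLM.injective.injOn (Set.mapsTo_preimage _ _)
  have hmeas : MeasurableSet (Complex.equivRealProdCLM ⁻¹' S) :=
    Complex.equivRealProdCLM.continuous.measurable hS
  rw [hypArea, ← image_comp_equivRealProdCLM,
    MeasureTheory.lintegral_image_eq_lintegral_abs_det_fderiv_mul _ hmeas
      (fun ξ hξ => hasFDerivWithinAt_comp_equivRealProdCLM hF hSsq hξ) hinj',
    ← Complex.volume_preserving_equiv_real_prod.setLIntegral_comp_preimage_emb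
      Complex.measurableEquivRealProd.measurableEmbedding]
  refine MeasureTheory.setLIntegral_congr_fun hmeas fun ξ _ => ?_
  simp only [det_comp_equivRealProdCLM]
  exact (ENNReal.ofReal_mul (abs_nonneg _)).symm

lemma hypArea_image_square (hF : ContDiffOn ℝ ∞ F square)
    (hinj : Set.InjOn F {p ∈ square | jacobian F p ≠ 0}) :
    hypArea (F '' square) =
      ∫⁻ p in square, ENNReal.ofReal (|jacobian F p| * (4 / (1 - ‖F p‖ ^ 2) ^ 2)) := by
  have himage : F '' {p ∈ square | jacobian F p ≠ 0} =ᵐ[MeasureTheory.volume] F '' square := by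
    have hunion : F '' square =
        F '' {p ∈ square | jacobian F p ≠ 0} ∪ F '' {p ∈ square | jacobian F p = 0} := by
      rw [← Set.image_union]
      congr 1
      ext p
      simp only [Set.mem_union, Set.mem_ofPred_eq]
      tauto
    rw [hunion]
    exact (MeasureTheory.union_ae_eq_left_of_ae_eq_empty
      (MeasureTheory.ae_eq_empty.2 (volume_image_jacobian_eq_zero hF))).symm
  rw [hypArea, ← MeasureTheory.setLIntegral_congr himage]
  have hsupp : (fun p => ENNReal.ofReal (|jacobian F p| * (4 / (1 - ‖F p‖ ^ 2) ^ 2))).support ⊆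
      {p | jacobian F p ≠ 0} := fun p hp hzero => hp (by simp [hzero])
  have hset : {p ∈ square | jacobian F p ≠ 0} = {p | jacobian F p ≠ 0} ∩ square :=
    Set.inter_comm _ _
  refine (hypArea_image hF (measurableSet_jacobian_ne_zero hF) (Set.sep_subset _ _) hinj).trans ?_
  rw [hset, ← MeasureTheory.Measure.restrict_restrict' isCompact_square.measurableSet,
    MeasureTheory.setLIntegral_eq_of_support_subset hsupp]

lemma hypArea_image_square_eq_integralOmega [NeZero n] (hF : ContDiffOn ℝ ∞ F square)
    (hFdisk : ∀ p ∈ square, F p ∈ disk) (hinj : Set.InjOn F {p ∈ square | jacobian F p ≠ 0})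
    (hsign : (∀ p ∈ square, 0 ≤ jacobian F p) ∨ ∀ p ∈ square, jacobian F p ≤ 0) :
    hypArea (F '' square) = ENNReal.ofReal |integralOmega (fun p => axis n (F p))| := by
  set f : ℝ × ℝ → ℝ := fun p => jacobian F p * (4 / (1 - ‖F p‖ ^ 2) ^ 2) with hf
  have hdensity (p : ℝ × ℝ) : 0 ≤ 4 / (1 - ‖F p‖ ^ 2) ^ 2 := by positivity
  have hcont : ContinuousOn f square := by
    refine (continuousOn_jacobian hF).mul
      (continuousOn_const.div ((continuousOn_const.sub (hF.continuousOn.norm.pow 2)).pow 2) ?_)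
    intro p hp
    have hpos := one_sub_norm_sq_pos (axis_mem_ball_iff (n := 1).2 (hFdisk p hp))
    rw [norm_axis] at hpos
    exact pow_ne_zero 2 hpos.ne'
  have hint : MeasureTheory.IntegrableOn f square := hcont.integrableOn_compact isCompact_square
  have habs : |∫ p in square, f p| = ∫ p in square, |f p| := by
    have hmeas := isCompact_square.measurableSet
    rcases hsign with hpos | hneg
    · have hfpos : ∀ p ∈ square, 0 ≤ f p := fun p hp => mul_nonneg (hpos p hp) (hdensity p)
      rw [abs_of_nonneg (MeasureTheory.setIntegral_nonneg hmeas hfpos)]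
      exact MeasureTheory.setIntegral_congr_fun hmeas fun p hp => (abs_of_nonneg (hfpos p hp)).symm
    · have hfneg : ∀ p ∈ square, f p ≤ 0 := fun p hp =>
        mul_nonpos_of_nonpos_of_nonneg (hneg p hp) (hdensity p)
      rw [abs_of_nonpos (MeasureTheory.setIntegral_nonpos hmeas hfneg),
        ← MeasureTheory.integral_neg]
      exact MeasureTheory.setIntegral_congr_fun hmeas fun p hp => (abs_of_nonpos (hfneg p hp)).symm
  rw [hypArea_image_square hF hinj, integralOmega_axis hF, habs,
    MeasureTheory.ofReal_integral_eq_lintegral_ofReal hint.abs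
      (Filter.Eventually.of_forall fun _ => abs_nonneg _)]
  simp only [hf, abs_mul, abs_of_nonneg (hdensity _)]

end areaFormula

section mobius

variable {α ζ : ℂ}

lemma one_sub_conj_mul_ne_zero (hα : α ∈ disk) (hζ : ζ ∈ disk) :
    1 - (starRingEnd ℂ) α * ζ ≠ 0 := by
  simpa [inner_axis_left, axis_apply_zero] using one_sub_inner_ne_zero
    (axis_mem_ball_iff (n := 1).2 hα) (axis_mem_ball_iff (n := 1).2 hζ)

lemma one_sub_norm_sq_mobius (hα : α ∈ disk) (hζ : ζ ∈ disk) :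
    (1 - ‖mobius α ζ‖ ^ 2) * ‖1 - (starRingEnd ℂ) α * ζ‖ ^ 2 =
      (1 - ‖α‖ ^ 2) * (1 - ‖ζ‖ ^ 2) := by
  have hαb := axis_mem_ball_iff (n := 1).2 hα
  have hζb := axis_mem_ball_iff (n := 1).2 hζ
  simpa only [rho_eq_norm_act_exchange hαb hζb, act_exchange_axis hα, norm_axis, inner_axis_left,
    axis_apply_zero] using one_sub_rho_sq hαb hζb

lemma mobius_self (α : ℂ) : mobius α α = 0 := by rw [mobius, sub_self, zero_div]

lemma mobius_mobius (hα : α ∈ disk) (hζ : ζ ∈ disk) : mobius α (mobius α ζ) = ζ := by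
  have h := act_exchange_act_exchange (p := axis 1 α) (axis_mem_ball_iff (n := 1).2 hζ)
  rw [act_exchange_axis hα, act_exchange_axis hα] at h
  exact axis_injective h

lemma hasDerivAt_mobius (h : 1 - (starRingEnd ℂ) α * ζ ≠ 0) :
    HasDerivAt (mobius α)
      (-(1 - ‖α‖ ^ 2 : ℝ) / (1 - (starRingEnd ℂ) α * ζ) ^ 2) ζ := by
  refine (((hasDerivAt_id ζ).const_sub α).div
    (((hasDerivAt_id ζ).const_mul ((starRingEnd ℂ) α)).const_sub 1) h).congr_deriv ?_
  congr 1
  simp only [id]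
  push_cast
  linear_combination Complex.mul_conj' α

lemma hypArea_mobius_image {S : Set ℂ} (hα : α ∈ disk) (hS : MeasurableSet S) (hSd : S ⊆ disk) :
    hypArea (mobius α '' S) = hypArea S := by
  have hinj : Set.InjOn (mobius α) S := fun ζ hζ ξ hξ h => by
    rw [← mobius_mobius hα (hSd hζ), h, mobius_mobius hα (hSd hξ)]
  have hderiv (ζ) (hζ : ζ ∈ S) := ((hasDerivAt_mobius (one_sub_conj_mul_ne_zero hα
    (hSd hζ))).hasFDerivAt.restrictScalars ℝ).hasFDerivWithinAt (s := S)
  rw [hypArea, MeasureTheory.lintegral_image_eq_lintegral_abs_det_fderiv_mul _ hS hderiv hinj,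
    hypArea]
  refine MeasureTheory.setLIntegral_congr_fun hS fun ζ hζ => ?_
  have hdet (c : ℂ) :
      ((ContinuousLinearMap.toSpanSingleton ℂ c).restrictScalars ℝ).det = ‖c‖ ^ 2 := by
    rw [← Complex.normSq_eq_norm_sq, ← Algebra.norm_complex_apply, Algebra.norm_apply]
    refine congrArg LinearMap.det (LinearMap.ext fun ξ => ?_)
    simp [mul_comm]
  have hmob := one_sub_norm_sq_mobius hα (hSd hζ)
  have hD := norm_pos_iff.2 (one_sub_conj_mul_ne_zero hα (hSd hζ))
  have hα₁ := one_sub_norm_sq_pos (axis_mem_ball_iff (n := 1).2 hα)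
  have hζ₁ := one_sub_norm_sq_pos (axis_mem_ball_iff (n := 1).2 (hSd hζ))
  rw [norm_axis] at hα₁ hζ₁
  have hmob' := eq_div_of_mul_eq (pow_pos hD 2).ne' hmob
  rw [← ENNReal.ofReal_mul (abs_nonneg _), hdet, abs_of_nonneg (by positivity), norm_div, norm_neg,
    Complex.norm_real, Real.norm_of_nonneg hα₁.le, norm_pow, hmob']
  congr 1
  field_simp

end mobius

/-- The cone with apex `0` over the geodesic segment from `b` to `c` in the disk: the second
parameter runs along the segment, the first one along the rays from `0`. -/
def cone (b c : ℂ) (p : ℝ × ℝ) : ℂ := p.1 * mobius b (p.2 * mobius b c)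

section cone

variable {b c : ℂ}

lemma segmentPath_zero_axis [NeZero n] (hb : b ∈ disk) (p : ℝ × ℝ) :
    segmentPath 0 (segmentPath (axis n b) (axis n c) p.2) p.1 = axis n (cone b c p) := by
  rw [segmentPath_zero_left, segmentPath_axis hb, ← axis_smul, cone]

lemma isSpanningSurface_cone [NeZero n] (hb : b ∈ disk) (hc : c ∈ disk) :
    IsSpanningSurface 0 (axis n b) (axis n c) fun p => axis n (cone b c p) := by
  simpa only [segmentPath_zero_axis hb] using isSpanningSurface_segmentPath zero_mem_ball
    (axis_mem_ball_iff (n := n).2 hb) (axis_mem_ball_iff (n := n).2 hc)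

lemma cone_mem_disk (hb : b ∈ disk) (hc : c ∈ disk) {p : ℝ × ℝ} (hp : p ∈ square) :
    cone b c p ∈ disk :=
  axis_mem_ball_iff (n := 1).1 ((isSpanningSurface_cone hb hc).mem_ball p hp)

lemma contDiffOn_cone (hb : b ∈ disk) (hc : c ∈ disk) : ContDiffOn ℝ ∞ (cone b c) square := by
  simpa [Function.comp_def, axis_apply_zero] using
    ((EuclideanSpace.proj (𝕜 := ℂ) (0 : Fin 1)).restrictScalars ℝ).contDiff.comp_contDiffOn
      (isSpanningSurface_cone (n := 1) hb hc).smooth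

lemma jacobian_cone (hb : b ∈ disk) (hc : c ∈ disk) {p : ℝ × ℝ} (hp : p ∈ square) :
    jacobian (cone b c) p = p.1 * ((starRingEnd ℂ) (mobius b (p.2 * mobius b c)) *
      (-(1 - ‖b‖ ^ 2 : ℝ) / (1 - (starRingEnd ℂ) b * (p.2 * mobius b c)) ^ 2 * mobius b c)).im := by
  have hD := one_sub_conj_mul_ne_zero hb (ofReal_mul_mem_disk (mobius_mem_disk hb hc) hp.2)
  have hline : HasDerivAt (fun t : ℝ => (t : ℂ) * mobius b c) (mobius b c) p.2 := by
    simpa using (hasDerivAt_id p.2).ofReal_comp.mul_const (mobius b c)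
  have hsegment := ((hasDerivAt_mobius hD).comp p.2 hline).hasFDerivAt.comp p hasFDerivAt_snd
  have hradius : HasFDerivAt (fun p : ℝ × ℝ => (p.1 : ℂ)) _ p :=
    Complex.ofRealCLM.hasFDerivAt.comp p hasFDerivAt_fst
  have hcone : HasFDerivAt (cone b c) _ p := hradius.mul hsegment
  rw [jacobian, hcone.hasFDerivWithinAt.fderivWithin (uniqueDiffOn_square p hp),
    ← Complex.im_ofReal_mul]
  congr 1
  simp
  ring

lemma im_conj_mobius_mul_mobius {b m : ℂ} {t t' : ℝ} (h : 1 - (starRingEnd ℂ) b * (t * m) ≠ 0)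
    (h' : 1 - (starRingEnd ℂ) b * (t' * m) ≠ 0) :
    ((starRingEnd ℂ) (mobius b (t * m)) * mobius b (t' * m)).im *
        (‖1 - (starRingEnd ℂ) b * (t * m)‖ ^ 2 * ‖1 - (starRingEnd ℂ) b * (t' * m)‖ ^ 2) =
      (t - t') * ((1 - ‖b‖ ^ 2) * (1 - t * t' * ‖m‖ ^ 2)) * ((starRingEnd ℂ) b * m).im := by
  have hnum : (starRingEnd ℂ) (mobius b (t * m)) * mobius b (t' * m) *
      ((‖1 - (starRingEnd ℂ) b * (t * m)‖ ^ 2 * ‖1 - (starRingEnd ℂ) b * (t' * m)‖ ^ 2 : ℝ) : ℂ) =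
      (starRingEnd ℂ) (b - t * m) * (1 - (starRingEnd ℂ) b * (t * m)) *
        ((b - t' * m) * (starRingEnd ℂ) (1 - (starRingEnd ℂ) b * (t' * m))) := by
    push_cast
    rw [mobius, mobius, map_div₀, ← Complex.mul_conj', ← Complex.mul_conj', div_mul_div_comm,
      div_mul_eq_mul_div, div_eq_iff (mul_ne_zero ((map_ne_zero (starRingEnd ℂ)).2 h) h')]
    ring
  rw [← Complex.im_mul_ofReal, hnum, ← Complex.normSq_eq_norm_sq, ← Complex.normSq_eq_norm_sq]
  simp [Complex.normSq_apply]
  ring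

lemma im_conj_mobius_mul_deriv {b m : ℂ} {t : ℝ} (h : 1 - (starRingEnd ℂ) b * (t * m) ≠ 0) :
    ((starRingEnd ℂ) (mobius b (t * m)) *
        (-(1 - ‖b‖ ^ 2 : ℝ) / (1 - (starRingEnd ℂ) b * (t * m)) ^ 2 * m)).im *
        ‖1 - (starRingEnd ℂ) b * (t * m)‖ ^ 4 =
      -((1 - ‖b‖ ^ 2) * (1 - t ^ 2 * ‖m‖ ^ 2)) * ((starRingEnd ℂ) b * m).im := by
  have hnum : (starRingEnd ℂ) (mobius b (t * m)) *
      (-(1 - ‖b‖ ^ 2 : ℝ) / (1 - (starRingEnd ℂ) b * (t * m)) ^ 2 * m) *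
      ((‖1 - (starRingEnd ℂ) b * (t * m)‖ ^ 4 : ℝ) : ℂ) =
      (-(1 - ‖b‖ ^ 2) : ℝ) *
        ((starRingEnd ℂ) ((b - t * m) * (1 - (starRingEnd ℂ) b * (t * m))) * m) := by
    have hfour (D : ℂ) : (‖D‖ : ℂ) ^ 4 = (D * (starRingEnd ℂ) D) ^ 2 := by
      rw [Complex.mul_conj', ← pow_mul]
    have hconj := (map_ne_zero (starRingEnd ℂ)).2 h
    rw [mobius, map_div₀, Complex.ofReal_pow, hfour, map_mul, Complex.ofReal_neg]
    generalize 1 - (starRingEnd ℂ) b * (t * m) = D at h hconj ⊢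
    field_simp
  rw [← Complex.im_mul_ofReal, hnum, Complex.im_ofReal_mul, ← Complex.normSq_eq_norm_sq,
    ← Complex.normSq_eq_norm_sq]
  simp [Complex.normSq_apply]
  ring

lemma exists_jacobian_cone_eq (hb : b ∈ disk) (hc : c ∈ disk) {p : ℝ × ℝ} (hp : p ∈ square) :
    ∃ w > 0, jacobian (cone b c) p = -(p.1 * w) * ((starRingEnd ℂ) b * mobius b c).im := by
  have hm := mobius_mem_disk hb hc
  have htm := ofReal_mul_mem_disk hm hp.2
  have hD := one_sub_conj_mul_ne_zero hb htm
  have hb₁ := one_sub_norm_sq_pos (axis_mem_ball_iff (n := 1).2 hb)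
  have htm₁ := one_sub_norm_sq_pos (axis_mem_ball_iff (n := 1).2 htm)
  rw [norm_axis] at hb₁ htm₁
  rw [norm_mul, mul_pow, Complex.norm_real, Real.norm_eq_abs, sq_abs] at htm₁
  have hD₁ : 0 < ‖1 - (starRingEnd ℂ) b * (p.2 * mobius b c)‖ ^ 4 := by positivity
  refine ⟨(1 - ‖b‖ ^ 2) * (1 - p.2 ^ 2 * ‖mobius b c‖ ^ 2) /
    ‖1 - (starRingEnd ℂ) b * (p.2 * mobius b c)‖ ^ 4, by positivity, ?_⟩
  rw [jacobian_cone hb hc hp, eq_div_of_mul_eq hD₁.ne' (im_conj_mobius_mul_deriv hD)]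
  ring

lemma jacobian_cone_nonneg_or_nonpos (hb : b ∈ disk) (hc : c ∈ disk) :
    (∀ p ∈ square, 0 ≤ jacobian (cone b c) p) ∨ ∀ p ∈ square, jacobian (cone b c) p ≤ 0 := by
  refine (le_total ((starRingEnd ℂ) b * mobius b c).im 0).imp (fun h p hp => ?_) fun h p hp => ?_
  all_goals
    obtain ⟨w, hw, heq⟩ := exists_jacobian_cone_eq hb hc hp
    have hpw : 0 ≤ p.1 * w := mul_nonneg hp.1.1 hw.le
    rw [heq]
  · exact mul_nonneg_of_nonpos_of_nonpos (neg_nonpos.2 hpw) h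
  · exact mul_nonpos_of_nonpos_of_nonneg (neg_nonpos.2 hpw) h

/-- Two points of the cone on the same ray satisfy `Im (conj (cone p) * cone q) = 0`; this
determines the parameter along the base, and then the radius. -/
lemma injOn_cone (hb : b ∈ disk) (hc : c ∈ disk) :
    Set.InjOn (cone b c) {p ∈ square | jacobian (cone b c) p ≠ 0} := by
  rintro ⟨s, t⟩ ⟨hp, hpJ⟩ ⟨s', t'⟩ ⟨hq, hqJ⟩ heq
  have hm := mobius_mem_disk hb hc
  have htm := ofReal_mul_mem_disk hm hp.2
  have htm' := ofReal_mul_mem_disk hm hq.2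
  have hb₁ := one_sub_norm_sq_pos (axis_mem_ball_iff (n := 1).2 hb)
  rw [norm_axis] at hb₁
  have htt' : 0 < 1 - t * t' * ‖mobius b c‖ ^ 2 := by
    have hm₁ : ‖mobius b c‖ ^ 2 < 1 := pow_lt_one₀ (norm_nonneg _) (mem_disk_iff.1 hm) two_ne_zero
    nlinarith [mul_le_one₀ hp.2.2 hq.2.1 hq.2.2, sq_nonneg ‖mobius b c‖]
  have him := im_conj_mobius_mul_mobius (one_sub_conj_mul_ne_zero hb htm)
    (one_sub_conj_mul_ne_zero hb htm')
  obtain ⟨w, -, hw⟩ := exists_jacobian_cone_eq hb hc hp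
  obtain ⟨w', -, hw'⟩ := exists_jacobian_cone_eq hb hc hq
  have hs : s ≠ 0 := by rintro rfl; simp [hw] at hpJ
  have hs' : s' ≠ 0 := by rintro rfl; simp [hw'] at hqJ
  have hκ : ((starRingEnd ℂ) b * mobius b c).im ≠ 0 := fun h => hpJ (by rw [hw, h, mul_zero])
  have hγ : mobius b (t * mobius b c) ≠ 0 := fun h => hpJ (by simp [jacobian_cone hb hc hp, h])
  have hcross : ((starRingEnd ℂ) (mobius b (t * mobius b c)) *
      mobius b (t' * mobius b c)).im = 0 := by
    have : s' * ((starRingEnd ℂ) (mobius b (t * mobius b c)) *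
        mobius b (t' * mobius b c)).im = 0 := by
      calc _ = ((starRingEnd ℂ) (mobius b (t * mobius b c)) * cone b c (s', t')).im := by
            rw [← Complex.im_ofReal_mul, cone]; ring_nf
        _ = (s * (mobius b (t * mobius b c) * (starRingEnd ℂ) (mobius b (t * mobius b c)))).im := by
            rw [← heq, cone]; ring_nf
        _ = 0 := by rw [Complex.mul_conj, ← Complex.ofReal_mul, Complex.ofReal_im]
    exact (mul_eq_zero.1 this).resolve_left hs'
  have ht : t = t' := by
    rw [hcross, zero_mul, eq_comm, mul_eq_zero, mul_eq_zero] at him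
    exact sub_eq_zero.1 ((him.resolve_right hκ).resolve_right (mul_pos hb₁ htt').ne')
  subst ht
  exact Prod.ext (Complex.ofReal_injective (mul_right_cancel₀ hγ heq)) rfl

lemma hypArea_cone [NeZero n] (hb : b ∈ disk) (hc : c ∈ disk) :
    hypArea (cone b c '' square) =
      ENNReal.ofReal |2 * angularInvariant 0 (axis n b) (axis n c)| := by
  rw [hypArea_image_square_eq_integralOmega (n := n) (contDiffOn_cone hb hc)
    (fun p hp => cone_mem_disk hb hc hp) (injOn_cone hb hc) (jacobian_cone_nonneg_or_nonpos hb hc),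
    (isSpanningSurface_cone hb hc).integralOmega_eq zero_mem_ball (axis_mem_ball_iff.2 hb)
      (axis_mem_ball_iff.2 hc)]

end cone

section triangle

variable [NeZero n] {a b c : ℂ}

lemma setOf_axis_mem_solidTriangle_zero (hb : b ∈ disk) (hc : c ∈ disk) :
    {ζ | ζ ∈ disk ∧ axis n ζ ∈ solidTriangle 0 (axis n b) (axis n c)} = cone b c '' square := by
  have hbb := axis_mem_ball_iff (n := n).2 hb
  have hcb := axis_mem_ball_iff (n := n).2 hc
  ext ζ
  constructor
  · rintro ⟨-, w, hw, hζ⟩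
    obtain ⟨t, ht, rfl⟩ := (mem_geodesicSegment_iff hbb hcb).1 hw
    obtain ⟨s, hs, h⟩ := (mem_geodesicSegment_zero_iff hw.1).1 hζ
    rw [segmentPath_axis hb, ← axis_smul] at h
    exact ⟨(s, t), ⟨hs, ht⟩, (axis_injective h).symm⟩
  · rintro ⟨p, hp, rfl⟩
    have hw := segmentPath_mem_geodesicSegment hbb hcb hp.2
    refine ⟨cone_mem_disk hb hc hp, _, hw, (mem_geodesicSegment_zero_iff hw.1).2 ⟨p.1, hp.1, ?_⟩⟩
    rw [segmentPath_axis hb, ← axis_smul, cone]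

lemma hypArea_solidTriangle (ha : a ∈ disk) (hb : b ∈ disk) (hc : c ∈ disk) :
    hypArea {ζ | ζ ∈ disk ∧ axis n ζ ∈ solidTriangle (axis n a) (axis n b) (axis n c)} =
      ENNReal.ofReal |2 * angularInvariant (axis n a) (axis n b) (axis n c)| := by
  have hab := axis_mem_ball_iff (n := n).2 ha
  have hbb := axis_mem_ball_iff (n := n).2 hb
  have hcb := axis_mem_ball_iff (n := n).2 hc
  have hmb := mobius_mem_disk ha hb
  have hmc := mobius_mem_disk ha hc
  have hangular : angularInvariant 0 (axis n (mobius a b)) (axis n (mobius a c)) =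
      angularInvariant (axis n a) (axis n b) (axis n c) := by
    simpa only [act_exchange_axis ha, mobius_self, axis_zero] using
      angularInvariant_act (exchange (axis n a)) hab hbb hcb
  have hmem (ζ) (hζ : ζ ∈ disk) : axis n (mobius a ζ) ∈
      solidTriangle 0 (axis n (mobius a b)) (axis n (mobius a c)) ↔
      axis n ζ ∈ solidTriangle (axis n a) (axis n b) (axis n c) := by
    simpa only [act_exchange_axis ha, mobius_self, axis_zero] using
      act_mem_solidTriangle_iff (exchange (axis n a)) hab hbb hcb (axis_mem_ball_iff.2 hζ)
  have himage : {ζ | ζ ∈ disk ∧ axis n ζ ∈ solidTriangle (axis n a) (axis n b) (axis n c)} =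
      mobius a '' (cone (mobius a b) (mobius a c) '' square) := by
    rw [← setOf_axis_mem_solidTriangle_zero (n := n) hmb hmc]
    ext ζ
    constructor
    · rintro ⟨hζ, h⟩
      exact ⟨mobius a ζ, ⟨mobius_mem_disk ha hζ, (hmem ζ hζ).2 h⟩, mobius_mobius ha hζ⟩
    · rintro ⟨ξ, ⟨hξ, h⟩, rfl⟩
      refine ⟨mobius_mem_disk ha hξ, (hmem _ (mobius_mem_disk ha hξ)).1 ?_⟩
      rwa [mobius_mobius ha hξ]
  have hcompact : IsCompact (cone (mobius a b) (mobius a c) '' square) :=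
    isCompact_square.image_of_continuousOn (contDiffOn_cone hmb hmc).continuousOn
  rw [himage, hypArea_mobius_image ha hcompact.measurableSet
    (Set.image_subset_iff.2 fun p hp => cone_mem_disk hmb hmc hp), hypArea_cone (n := n) hmb hmc,
    hangular]

end triangle

/-! ### Projection to a complex geodesic -/

section projection

variable [NeZero n]

lemma inner_axis_apply_zero {y z : Cn n} (h : axis n (y 0) = y ∨ axis n (z 0) = z) :
    inner ℂ (axis n (y 0)) (axis n (z 0)) = inner ℂ y z := by
  rcases h with h | h
  · rw [inner_axis_left, axis_apply_zero, ← inner_axis_left, h]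
  · rw [inner_axis_right, axis_apply_zero, ← inner_axis_right, h]

lemma axis_footCoord_of_mem_slice {T : unitaryGroup n} {x : Cn n} (hx : x ∈ slice T) :
    axis n (footCoord T x) = act T⁻¹ x := by
  obtain ⟨ζ, hζ, rfl⟩ := hx
  rw [footCoord, act_inv_act T (axis_mem_ball_iff.2 hζ), axis_apply_zero]

/-- The angular invariant only involves inner products of distinct points of the triple, and
the projection does not change an inner product one of whose arguments lies on the slice. -/
lemma angularInvariant_axis_footCoord {T : unitaryGroup n} {x : Fin 3 → Cn n}
    (hx : ∀ k, x k ∈ ball n) {i j : Fin 3} (hij : i ≠ j) (hi : x i ∈ slice T)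
    (hj : x j ∈ slice T) :
    angularInvariant (axis n (footCoord T (x 0))) (axis n (footCoord T (x 1)))
      (axis n (footCoord T (x 2))) = angularInvariant (x 0) (x 1) (x 2) := by
  have hkernel (k l : Fin 3) (hkl : k ≠ l) : kernel (axis n (footCoord T (x k)))
      (axis n (footCoord T (x l))) = kernel (act T⁻¹ (x k)) (act T⁻¹ (x l)) := by
    rw [kernel, kernel]
    congr 2
    refine inner_axis_apply_zero ?_
    have : k = i ∨ k = j ∨ l = i ∨ l = j := by omega
    rcases this with rfl | rfl | rfl | rfl
    exacts [.inl (axis_footCoord_of_mem_slice hi), .inl (axis_footCoord_of_mem_slice hj),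
      .inr (axis_footCoord_of_mem_slice hi), .inr (axis_footCoord_of_mem_slice hj)]
  rw [← angularInvariant_act T⁻¹ (hx 0) (hx 1) (hx 2), angularInvariant, angularInvariant,
    hkernel 0 1 (by decide), hkernel 1 2 (by decide), hkernel 2 0 (by decide)]

lemma hypArea_projection {x : Fin 3 → Cn n} (hx : ∀ k, x k ∈ ball n) {i j : Fin 3} (hij : i ≠ j)
    {G : Set (Cn n)} (hi : x i ∈ G) (hj : x j ∈ G) {p : Fin 3 → Cn n}
    (hp : ∀ k, IsNearestPoint G (x k) (p k)) {ψ : ℂ → Cn n} (hψ : IsDiskChart ψ G) :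
    hypArea {ζ | ζ ∈ disk ∧ ψ ζ ∈ solidTriangle (p 0) (p 1) (p 2)} =
      ENNReal.ofReal |2 * angularInvariant (x 0) (x 1) (x 2)| := by
  obtain ⟨T, hψT, rfl⟩ := hψ.exists_slice
  have hfoot (k) : footCoord T (x k) ∈ disk := footCoord_mem_disk T (hx k)
  have hfootb (k) : axis n (footCoord T (x k)) ∈ ball n := axis_mem_ball_iff.2 (hfoot k)
  have hpT (k) : p k = act T (axis n (footCoord T (x k))) :=
    (isNearestPoint_slice_iff T (hx k)).1 (hp k)
  have hset : {ζ | ζ ∈ disk ∧ ψ ζ ∈ solidTriangle (p 0) (p 1) (p 2)} =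
      {ζ | ζ ∈ disk ∧ axis n ζ ∈ solidTriangle (axis n (footCoord T (x 0)))
        (axis n (footCoord T (x 1))) (axis n (footCoord T (x 2)))} := by
    ext ζ
    refine and_congr_right fun hζ => ?_
    rw [hψT hζ, hpT, hpT, hpT, act_mem_solidTriangle_iff T (hfootb 0) (hfootb 1) (hfootb 2)
      (axis_mem_ball_iff.2 hζ)]
  rw [hset, hypArea_solidTriangle (hfoot 0) (hfoot 1) (hfoot 2),
    angularInvariant_axis_footCoord hx hij hi hj]

end projection

end CHyp

end

theorem theorem5p7 (n : ℕ) (x : Fin 3 → CHyp.Cn n) (hx : ∀ k, x k ∈ CHyp.ball n)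
    (hinj : Function.Injective x) :
    ∃ SA : ℝ, CHyp.HasSymplecticArea (x 0) (x 1) (x 2) SA ∧
      |SA / 2| = |CHyp.angularInvariant (x 0) (x 1) (x 2)| ∧
      ∀ i j : Fin 3, i ≠ j →
        (∃! G : Set (CHyp.Cn n), CHyp.IsComplexGeodesic G ∧
          CHyp.geodesicSegment (x i) (x j) ⊆ G) ∧
        ∀ G : Set (CHyp.Cn n), CHyp.IsComplexGeodesic G →
          CHyp.geodesicSegment (x i) (x j) ⊆ G →
          (∀ k, ∃! p, CHyp.IsNearestPoint G (x k) p) ∧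
          ∀ p : Fin 3 → CHyp.Cn n, (∀ k, CHyp.IsNearestPoint G (x k) (p k)) →
            ∀ ψ : ℂ → CHyp.Cn n, CHyp.IsDiskChart ψ G →
              CHyp.hypArea {ζ | ζ ∈ CHyp.disk ∧
                ψ ζ ∈ CHyp.solidTriangle (p 0) (p 1) (p 2)} / 2
                = ENNReal.ofReal |SA / 2| := by
  have : NeZero n := ⟨by
    rintro rfl
    exact absurd (hinj (Subsingleton.elim (x 0) (x 1))) (by decide)⟩
  refine ⟨2 * CHyp.angularInvariant (x 0) (x 1) (x 2),
    CHyp.hasSymplecticArea (hx 0) (hx 1) (hx 2), by rw [mul_div_cancel_left₀ _ two_ne_zero],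
    fun i j hij => ⟨CHyp.existsUnique_complexGeodesic (hx i) (hx j) (hinj.ne hij),
      fun G hG hsub => ⟨fun k => ?_, fun p hp ψ hψ => ?_⟩⟩⟩
  · obtain ⟨T, rfl⟩ := hG.exists_slice
    exact ⟨_, (CHyp.isNearestPoint_slice_iff T (hx k)).2 rfl,
      fun p hp => (CHyp.isNearestPoint_slice_iff T (hx k)).1 hp⟩
  · have hi := hsub (CHyp.left_mem_geodesicSegment (hx i) (hx j))
    have hj := hsub (CHyp.right_mem_geodesicSegment (hx i) (hx j))
    rw [CHyp.hypArea_projection hx hij hi hj hp hψ, abs_div, abs_two,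
      ENNReal.ofReal_div_of_pos two_pos, ENNReal.ofReal_ofNat]
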